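/- **Setting.** Let $L^2[0,1]$ be the real Hilbert space with inner product $\langle f,g\rangle=\int_0^1fg$ and let $(\psi_j)_{j\ge1}$ be an orthonormal basis. Let $\omega=(\omega_j)_{j\ge1}$ be a strictly positive sequence of weights which is bounded above or bounded away from $0$ (for instance, a monotone sequence). Put $\|f\|_\omega^2=\sum_j\omega_j\langle f,\psi_j\rangle^2\in[0,\infty]$, $\mathcal W_\omega=\{f\in L^2[0,1]:\|f\|_\omega<\infty\}$ and, for an operator $K$, $\|K\|_\omega=\sup_{\|f\|_\omega=1}\|Kf\|_\omega$. For $m\ge1$ let $[f]_{\underline m}=(\langle f,\psi_j\rangle)_{j\le m}$ and $[K]_{\underline m}=(\langle K\psi_j,\psi_i\rangle)_{i,j\le m}$, let $\Pi_m$ be the orthogonal projection onto $\mathrm{span}(\psi_1,\dots,\psi_m)$ and $\Pi_m^\perp=I-\Pi_m$. The norm of a matrix is the spectral norm. **Model.** Let $\sigma>0$, $\eta\ge1$, $\beta\in\mathcal W_\omega$ and $Y=\langle\beta,X\rangle+\sigma\epsilon$ with $\mathbb E[\epsilon X]=0$, where: * $X\in\mathcal X^4_\eta$, that is, $X$ is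 a centered random element of $L^2[0,1]$ with $\mathbb E\|X\|^2<\infty$, its covariance operator $\Gamma f=\mathbb E[\langle X,f\rangle X]$ is strictly positive, and $\mathbb E\bigl|\langle X,\psi_j\rangle/\langle\Gamma\psi_j,\psi_j\rangle^{1/2}\bigr|^4\le\eta$ for all $j\ge 1$ and $\mathbb E\bigl|([\Gamma]_{\underline m}^{-1/2}[X]_{\underline m})_j\bigr|^4\le\eta$ for all $1\le j\le m$, $m\ge 1$; * $\epsilon\in\mathcal E^4_\eta$, that is, $\mathbb E\epsilon=0$, $\mathrm{Var}(\epsilon)=1$ and $\mathbb E|\epsilon|^4\le\eta$. **Estimator.** Let $(Y_1,X_1),\dots,(Y_n,X_n)$ be i.i.d. copies of $(Y,X)$, $\widehat g=\frac1n\sum_iY_iX_i$ and $\widehat\Gamma=\frac1n\sum_i\langle X_i,\cdot\rangle X_i$. Given $m=m(n)$ and $\gamma=\gamma(n)$, let $\widehat\beta=\sum_{\ell=1}^m\bigl([\widehat\Gamma]_{\underline m}^{-1}[\widehat g]_{\underline m}\bigr)_\ell\psi_\ell$ if $[\widehat\Gamma]_{\underline m}$ is nonsingular and $\|[\widehat\Gamma]_{\underline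 m}^{-1}\|\le\gamma$, and $\widehat\beta=0$ otherwise. **Claim.** Suppose that $\gamma\ge2\|[\Gamma]_{\underline m}^{-1}\|$ and that, as $n\to\infty$, $m\to\infty$, $\gamma\,(m/n)\sup_{1\le j\le m}\omega_j\to0$, $m^2/n\to0$ and $\gamma^2m^3/n^{3/2}=O(1)$. Suppose also that $\sup_{m\ge 1}\|\Gamma_m^{-1}\Pi_m\Gamma\Pi_m^\perp\|_\omega<\infty$, where $\Gamma_m^{-1}$ is the operator whose matrix in the basis $(\psi_j)$ has upper left $m\times m$ block $[\Gamma]_{\underline m}^{-1}$ and zeros elsewhere. Then $\mathbb E\|\widehat\beta-\beta\|_\omega^2\to0$ as $n\to\infty$. -/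

import Mathlib

open MeasureTheory ProbabilityTheory Filter Topology
open scoped ENNReal

namespace FLR

/-- The real Hilbert space `L²[0,1]`. -/
abbrev L2I : Type := Lp ℝ 2 ((volume : Measure ℝ).restrict (Set.Icc (0 : ℝ) 1))

noncomputable instance instMeasurableSpaceL2I : MeasurableSpace L2I := borel L2I

instance instBorelSpaceL2I : BorelSpace L2I := ⟨rfl⟩

section Deterministic

variable {H : Type*} [NormedAddCommGroup H] [InnerProductSpace ℝ H]

/-- The squared weighted norm `‖f‖²_ω = ∑ⱼ ωⱼ ⟨f, ψⱼ⟩²`, with values in `[0, ∞]`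
(the basis is indexed from `0`, so `ψ j` and `ω j` are the objects of index `j + 1` in the usual
numbering). -/
noncomputable def wnormSq (ψ : HilbertBasis ℕ ℝ H) (ω : ℕ → ℝ) (f : H) : ℝ≥0∞ :=
  ∑' j, ENNReal.ofReal (ω j * (inner ℝ f (ψ j)) ^ 2)

/-- The weighted norm `‖f‖_ω`. -/
noncomputable def wnorm (ψ : HilbertBasis ℕ ℝ H) (ω : ℕ → ℝ) (f : H) : ℝ≥0∞ :=
  wnormSq ψ ω f ^ (1 / 2 : ℝ)

/-- The space `W_ω` of all `f` with finite weighted norm. -/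
def weightedSpace (ψ : HilbertBasis ℕ ℝ H) (ω : ℕ → ℝ) : Set H :=
  {f | wnormSq ψ ω f < ∞}

/-- The operator norm `‖K‖_ω = sup_{‖f‖_ω = 1} ‖K f‖_ω`, with values in `[0, ∞]`. -/
noncomputable def wopNorm (ψ : HilbertBasis ℕ ℝ H) (ω : ℕ → ℝ) (K : H → H) : ℝ≥0∞ :=
  ⨆ (f : H) (_ : wnorm ψ ω f = 1), wnorm ψ ω (K f)

/-- The vector `[f]_m` of the first `m` coefficients of `f`. -/
noncomputable def coeffs (ψ : HilbertBasis ℕ ℝ H) (m : ℕ) (f : H) : Fin m → ℝ :=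
  fun j => inner ℝ f (ψ j)

/-- The `m × m` matrix `[K]_m` with entries `⟨K ψⱼ, ψᵢ⟩`. -/
noncomputable def truncMatrix (ψ : HilbertBasis ℕ ℝ H) (m : ℕ) (K : H → H) :
    Matrix (Fin m) (Fin m) ℝ :=
  Matrix.of fun i j => inner ℝ (K (ψ j)) (ψ i)

/-- The function `v₁ ψ₁ + ⋯ + v_m ψ_m` with coefficient vector `v`. -/
noncomputable def synth (ψ : HilbertBasis ℕ ℝ H) (m : ℕ) (v : Fin m → ℝ) : H :=
  ∑ j : Fin m, v j • ψ j

/-- The orthogonal projection `Π_m` onto the span of the first `m` basis functions. -/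
noncomputable def proj (ψ : HilbertBasis ℕ ℝ H) (m : ℕ) (f : H) : H :=
  synth ψ m (coeffs ψ m f)

/-- The orthogonal projection `Π_m^⊥` onto the orthogonal complement of that span. -/
noncomputable def projPerp (ψ : HilbertBasis ℕ ℝ H) (m : ℕ) (f : H) : H :=
  f - proj ψ m f

/-- The operator `K_m⁻¹` whose matrix has upper left `m × m` block `[K]_m⁻¹` and zeros
elsewhere. -/
noncomputable def truncInv (ψ : HilbertBasis ℕ ℝ H) (m : ℕ) (K : H → H) (f : H) : H :=
  synth ψ m (Matrix.mulVec (truncMatrix ψ m K)⁻¹ (coeffs ψ m f))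

/-- The spectral norm of a square matrix: the operator norm for the Euclidean norm. -/
noncomputable def specNorm {m : ℕ} (A : Matrix (Fin m) (Fin m) ℝ) : ℝ :=
  ‖Matrix.toEuclideanCLM (n := Fin m) (𝕜 := ℝ) A‖

/-- The matrix `A^{-1/2}` of a symmetric positive definite matrix `A` (functional calculus). -/
noncomputable def invSqrt {m : ℕ} (A : Matrix (Fin m) (Fin m) ℝ) : Matrix (Fin m) (Fin m) ℝ :=
  cfc (fun t : ℝ => (Real.sqrt t)⁻¹) A

/-- The empirical cross covariance function `ĝ = n⁻¹ ∑ Yᵢ Xᵢ`. -/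
noncomputable def empG (n : ℕ) (y : ℕ → ℝ) (x : ℕ → H) : H :=
  (n : ℝ)⁻¹ • ∑ i ∈ Finset.range n, y i • x i

/-- The empirical covariance operator `Γ̂ = n⁻¹ ∑ ⟨Xᵢ, ·⟩ Xᵢ`. -/
noncomputable def empCov (n : ℕ) (x : ℕ → H) (f : H) : H :=
  (n : ℝ)⁻¹ • ∑ i ∈ Finset.range n, inner ℝ (x i) f • x i

open Classical in
/-- The thresholded projection estimator: the function with coefficient vector `[Γ̂]_m⁻¹ [ĝ]_m`
if `[Γ̂]_m` is nonsingular with `‖[Γ̂]_m⁻¹‖ ≤ γ`, and `0` otherwise. -/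
noncomputable def estimator (ψ : HilbertBasis ℕ ℝ H) (n m : ℕ) (γ : ℝ) (y : ℕ → ℝ) (x : ℕ → H) :
    H :=
  if IsUnit (truncMatrix ψ m (empCov n x)).det ∧
      specNorm (truncMatrix ψ m (empCov n x))⁻¹ ≤ γ then
    synth ψ m (Matrix.mulVec (truncMatrix ψ m (empCov n x))⁻¹ (coeffs ψ m (empG n y x)))
  else 0

end Deterministic

section Random

variable {Ω : Type*} [MeasurableSpace Ω]
variable {H : Type*} [NormedAddCommGroup H] [InnerProductSpace ℝ H] [CompleteSpace H]
  [MeasurableSpace H] [BorelSpace H]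

/-- The covariance operator of a centered random element `X`, that is `f ↦ E[⟨X, f⟩ X]`. -/
noncomputable def covOp (P : Measure Ω) (X : Ω → H) : H →L[ℝ] H :=
  covarianceOperator (P.map X)

/-- The class of centered random elements with finite second moment and strictly positive
covariance operator. -/
structure MemX (P : Measure Ω) (X : Ω → H) : Prop where
  aemeasurable : AEMeasurable X P
  memLp : MemLp X 2 P
  centered : ∫ w, X w ∂P = 0
  pos : ∀ f : H, f ≠ 0 → 0 < inner ℝ (covOp P X f) f

/-- The class `𝒳^k_η`: the `k`-th absolute moments of the standardized coefficients
`[X]ⱼ / [Γ]ⱼⱼ^{1/2}` and of the entries of `[Γ]_m^{-1/2} [X]_m` are bounded by `η`. -/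
structure MemXMoment (P : Measure Ω) (ψ : HilbertBasis ℕ ℝ H) (k : ℕ) (η : ℝ) (X : Ω → H) : Prop
    extends MemX P X where
  moment_coeff : ∀ j : ℕ,
    ∫⁻ w, ENNReal.ofReal
      (|inner ℝ (X w) (ψ j) / Real.sqrt (inner ℝ (covOp P X (ψ j)) (ψ j))| ^ k) ∂P
      ≤ ENNReal.ofReal η
  moment_std : ∀ (m : ℕ) (j : Fin m),
    ∫⁻ w, ENNReal.ofReal
      (|Matrix.mulVec (invSqrt (truncMatrix ψ m (covOp P X))) (coeffs ψ m (X w)) j| ^ k) ∂P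
      ≤ ENNReal.ofReal η

/-- The class `ℰ^k_η` of centered error terms with variance one and `k`-th absolute moment at
most `η`. -/
structure MemE (P : Measure Ω) (k : ℕ) (η : ℝ) (ε : Ω → ℝ) : Prop where
  aemeasurable : AEMeasurable ε P
  memLp : MemLp ε 2 P
  centered : ∫ w, ε w ∂P = 0
  variance_one : Var[ε; P] = 1
  moment : ∫⁻ w, ENNReal.ofReal (|ε w| ^ k) ∂P ≤ ENNReal.ofReal η

/-- The functional linear model `Y = ⟨β, X⟩ + σ ε` with an error uncorrelated with `X`. -/
structure LinearModel (P : Measure Ω) (β : H) (σ : ℝ) (X : Ω → H) (ε Y : Ω → ℝ) : Prop where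
  eq : ∀ᵐ w ∂P, Y w = inner ℝ β (X w) + σ * ε w
  uncorrelated : ∫ w, ε w • X w ∂P = 0

/-- `(Yᵢ, Xᵢ)`, `i = 0, 1, …`, are independent copies of `(Y, X)`. -/
structure IsSample (P : Measure Ω) (X : Ω → H) (Y : Ω → ℝ) (Xs : ℕ → Ω → H) (Ys : ℕ → Ω → ℝ) :
    Prop where
  indep : iIndepFun (fun i w => (Ys i w, Xs i w)) P
  ident : ∀ i, IdentDistrib (fun w => (Ys i w, Xs i w)) (fun w => (Y w, X w)) P P

end Random

end FLR

/-! Write `G = [Γ]_m`, `A = [Γ̂]_m`, and let `b = G⁻¹[Γβ]_m` be the Galerkin coefficients of `β`.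
When the estimator is not thresholded, its error is the bias of `b` plus `A⁻¹T`, where `T = [ĝ]_m -
A b` averages residual times regressor. The bias is the operator bounded by `hΓ` applied to the tail
of `β`, minus that tail, so it vanishes (`tendsto_wnormSq_synth_galerkinCoeffs_sub`).

The normal equations make `T` centred. If `G ≤ 2A` as quadratic forms, the threshold is passed and
`|A⁻¹T|² ≤ 4‖G⁻¹‖ |G^{-1/2}T|²`, which costs a single factor `γ`. The mean of `|G^{-1/2}T|²` is `O(l
m / n)` when the fourth moment of the residual is `O(l²)` (`Isotropic.lintegral_score_le`).

If `G ≤ 2A` fails, only `‖A⁻¹‖ ≤ γ` is available. Fourth moments leave no room for Hölder's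
inequality between `|T|²` and the indicator of the rare event, so a leave-one-out argument is used:
`|T|²` is at most the average of the squared single contributions, and failure implies, for every
`i`, a deviation event that does not involve observation `i`. Each contribution is independent of
its own event, and expectations factor. Truncation and a Chernoff bound give these events
probability at most `2m² exp(-n / (256 η m³))`.

Since `Γ` has finite trace, `m ≤ ‖G⁻¹‖ tr G` makes `γ` at least of order `m`; then `γ⁴m⁶ = O(n³)`
forces `m¹⁰ = O(n³)`, and the exponential beats every power of `n`. Finally, weights bounded below
allow `l = 1`, because the bias then vanishes in `L²` too. Weights bounded above allow `l = m`,
because `γ m² / n → 0`. -/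

namespace FLR

/-! ### Spectral norms, inverse square roots and perturbation of inverses. -/

section LinearAlgebra

open Matrix

variable {m : ℕ}

lemma norm_toLp_sq (v : Fin m → ℝ) : ‖WithLp.toLp 2 v‖ ^ 2 = v ⬝ᵥ v := by
  rw [EuclideanSpace.norm_sq_eq]
  simp [dotProduct, sq]

lemma dotProduct_self_nonneg' (v : Fin m → ℝ) : 0 ≤ v ⬝ᵥ v := by
  rw [← norm_toLp_sq]; positivity

lemma dotProduct_sq_le (v w : Fin m → ℝ) : (v ⬝ᵥ w) ^ 2 ≤ (v ⬝ᵥ v) * (w ⬝ᵥ w) := by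
  simpa [dotProduct, sq] using Finset.sum_mul_sq_le_sq_mul_sq Finset.univ v w

lemma specNorm_nonneg (A : Matrix (Fin m) (Fin m) ℝ) : 0 ≤ specNorm A := norm_nonneg _

lemma mulVec_dotProduct_self_le (A : Matrix (Fin m) (Fin m) ℝ) (v : Fin m → ℝ) :
    (A *ᵥ v) ⬝ᵥ (A *ᵥ v) ≤ specNorm A ^ 2 * (v ⬝ᵥ v) := by
  rw [← norm_toLp_sq, ← norm_toLp_sq, ← mul_pow, ← toEuclideanCLM_toLp]
  gcongr
  exact ContinuousLinearMap.le_opNorm _ _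

lemma specNorm_le {A : Matrix (Fin m) (Fin m) ℝ} {c : ℝ} (hc : 0 ≤ c)
    (h : ∀ v, (A *ᵥ v) ⬝ᵥ (A *ᵥ v) ≤ c ^ 2 * (v ⬝ᵥ v)) : specNorm A ≤ c := by
  refine ContinuousLinearMap.opNorm_le_bound _ hc fun x => ?_
  have := h x.ofLp
  rw [← norm_toLp_sq, ← norm_toLp_sq, ← mul_pow, ← toEuclideanCLM_toLp] at this
  exact le_of_sq_le_sq this (by positivity)

lemma dotProduct_mulVec_le (A : Matrix (Fin m) (Fin m) ℝ) (v : Fin m → ℝ) :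
    v ⬝ᵥ A *ᵥ v ≤ specNorm A * (v ⬝ᵥ v) := by
  have h1 := dotProduct_sq_le v (A *ᵥ v)
  have h2 := mulVec_dotProduct_self_le A v
  have h3 := dotProduct_self_nonneg' v
  have h4 := specNorm_nonneg A
  refine le_of_sq_le_sq ?_ (by positivity)
  nlinarith [mul_le_mul_of_nonneg_left h2 h3]

variable {G : Matrix (Fin m) (Fin m) ℝ}

lemma transpose_invSqrt (G : Matrix (Fin m) (Fin m) ℝ) : (invSqrt G)ᵀ = invSqrt G := by
  have h : IsSelfAdjoint (invSqrt G) := cfc_predicate _ _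
  have h2 : (invSqrt G)ᴴ = invSqrt G := h
  rwa [conjTranspose_eq_transpose_of_trivial] at h2

lemma spectrum_pos_of_posDef (hG : G.PosDef) {t : ℝ} (ht : t ∈ spectrum ℝ G) : 0 < t := by
  rw [hG.isHermitian.spectrum_real_eq_range_eigenvalues] at ht
  obtain ⟨i, rfl⟩ := ht
  exact hG.eigenvalues_pos i

/-- The spectrum lies in `(0, ∞)`, where `t ↦ t^{-1/2}` is continuous and `t^{-1/2} · t · t^{-1/2} =
1`. -/
lemma invSqrt_mul_mul_invSqrt (hG : G.PosDef) : invSqrt G * G * invSqrt G = 1 := by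
  have hsa : IsSelfAdjoint G := hG.isHermitian
  have hc : ContinuousOn (fun t : ℝ => (Real.sqrt t)⁻¹) (spectrum ℝ G) :=
    Real.continuous_sqrt.continuousOn.inv₀ fun t ht =>
      (Real.sqrt_pos.2 (spectrum_pos_of_posDef hG ht)).ne'
  have h1 : invSqrt G * G = cfc (fun t : ℝ => (Real.sqrt t)⁻¹ * t) G := by
    rw [cfc_mul (fun t : ℝ => (Real.sqrt t)⁻¹) (fun t => t) G hc continuousOn_id, cfc_id' ℝ G]
    rfl
  have h2 : invSqrt G * G * invSqrt G
      = cfc (fun t : ℝ => (Real.sqrt t)⁻¹ * t * (Real.sqrt t)⁻¹) G := by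
    rw [cfc_mul (fun t : ℝ => (Real.sqrt t)⁻¹ * t) (fun t => (Real.sqrt t)⁻¹) G
      (hc.mul continuousOn_id) hc, ← h1]
    rfl
  rw [h2, ← cfc_one ℝ G]
  refine cfc_congr fun t ht => ?_
  have ht := spectrum_pos_of_posDef hG ht
  have h3 := Real.sqrt_pos.2 ht
  have h4 := Real.mul_self_sqrt ht.le
  simp only [Pi.one_apply]
  field_simp
  nlinarith

lemma isUnit_invSqrt_det (hG : G.PosDef) : IsUnit (invSqrt G).det := by
  have h := congrArg det (invSqrt_mul_mul_invSqrt hG)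
  rw [det_mul, det_one] at h
  exact IsUnit.of_mul_eq_one_right _ h

lemma inv_eq_invSqrt_mul (hG : G.PosDef) : G⁻¹ = invSqrt G * invSqrt G := by
  refine inv_eq_left_inv ?_
  rw [mul_assoc, mul_eq_one_comm]
  exact invSqrt_mul_mul_invSqrt hG

lemma invSqrt_mulVec_dotProduct (v w : Fin m → ℝ) :
    (invSqrt G *ᵥ v) ⬝ᵥ w = v ⬝ᵥ (invSqrt G *ᵥ w) := by
  rw [dotProduct_mulVec, ← mulVec_transpose, transpose_invSqrt]

/-- The substitution `x = G^{-1/2} y` turns the form of `G` into the Euclidean one. -/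
lemma exists_invSqrt_mulVec_eq (hG : G.PosDef) (x : Fin m → ℝ) :
    ∃ y, invSqrt G *ᵥ y = x ∧ x ⬝ᵥ G *ᵥ x = y ⬝ᵥ y ∧ x ⬝ᵥ x ≤ specNorm G⁻¹ * (y ⬝ᵥ y) := by
  refine ⟨(invSqrt G)⁻¹ *ᵥ x, ?_⟩
  have h : invSqrt G *ᵥ ((invSqrt G)⁻¹ *ᵥ x) = x := by
    rw [mulVec_mulVec, mul_nonsing_inv _ (isUnit_invSqrt_det hG), one_mulVec]
  set y := (invSqrt G)⁻¹ *ᵥ x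
  refine ⟨h, ?_, ?_⟩
  · rw [← h, invSqrt_mulVec_dotProduct, mulVec_mulVec, mulVec_mulVec,
      invSqrt_mul_mul_invSqrt hG, one_mulVec]
  · refine le_trans (le_of_eq ?_) (dotProduct_mulVec_le _ y)
    rw [inv_eq_invSqrt_mul hG, ← mulVec_mulVec, ← invSqrt_mulVec_dotProduct, h]

lemma dotProduct_self_le_inv (hG : G.PosDef) (x : Fin m → ℝ) :
    x ⬝ᵥ x ≤ specNorm G⁻¹ * (x ⬝ᵥ G *ᵥ x) := by
  obtain ⟨y, -, h2, h3⟩ := exists_invSqrt_mulVec_eq hG x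
  rwa [h2]

/-- Each basis vector gives `1 ≤ ‖G⁻¹‖ G j j`. As the traces stay bounded by that of `Γ`, this
forces the threshold to grow at least linearly in `m`. -/
lemma card_le_specNorm_mul_trace (hG : G.PosDef) : (m : ℝ) ≤ specNorm G⁻¹ * ∑ j, G j j := by
  rw [Finset.mul_sum]
  have : (m : ℝ) = ∑ _j : Fin m, (1 : ℝ) := by simp
  rw [this]
  refine Finset.sum_le_sum fun j _ => ?_
  simpa using dotProduct_self_le_inv hG (Pi.single j 1)

variable {A : Matrix (Fin m) (Fin m) ℝ}

lemma isUnit_det_of_le (hG : G.PosDef) (h : ∀ v, v ⬝ᵥ G *ᵥ v ≤ 2 * (v ⬝ᵥ A *ᵥ v)) :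
    IsUnit A.det := by
  rw [isUnit_iff_ne_zero]
  intro h0
  obtain ⟨v, hv, hv2⟩ := exists_mulVec_eq_zero_iff.2 h0
  have h1 := h v
  have h2 := hG.dotProduct_mulVec_pos hv
  rw [hv2] at h1
  simp at h1 h2
  linarith

/-- With `x = A⁻¹t = G^{-1/2}y`, one has `|y|² = x·Gx ≤ 2 x·t = 2 y·G^{-1/2}t`, so `|y| ≤
2|G^{-1/2}t|`. Keeping the standardised vector on the right costs one factor `‖G⁻¹‖` instead of its
square. -/
lemma mulVec_inv_dotProduct_self_le (hG : G.PosDef)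
    (h : ∀ v, v ⬝ᵥ G *ᵥ v ≤ 2 * (v ⬝ᵥ A *ᵥ v)) (t : Fin m → ℝ) :
    (A⁻¹ *ᵥ t) ⬝ᵥ (A⁻¹ *ᵥ t)
      ≤ 4 * specNorm G⁻¹ * ((invSqrt G *ᵥ t) ⬝ᵥ (invSqrt G *ᵥ t)) := by
  have hu := isUnit_det_of_le hG h
  have hA : A *ᵥ (A⁻¹ *ᵥ t) = t := by rw [mulVec_mulVec, mul_nonsing_inv _ hu, one_mulVec]
  set x := A⁻¹ *ᵥ t
  obtain ⟨y, h1, h2, h3⟩ := exists_invSqrt_mulVec_eq hG x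
  have h4 := h x
  rw [hA, h2] at h4
  have h5 : x ⬝ᵥ t = y ⬝ᵥ (invSqrt G *ᵥ t) := by rw [← h1, invSqrt_mulVec_dotProduct]
  have h6 := dotProduct_sq_le y (invSqrt G *ᵥ t)
  rw [← h5] at h6
  have h7 := dotProduct_self_nonneg' y
  have h8 := dotProduct_self_nonneg' (invSqrt G *ᵥ t)
  have h9 : y ⬝ᵥ y ≤ 4 * ((invSqrt G *ᵥ t) ⬝ᵥ (invSqrt G *ᵥ t)) := by
    rcases h7.eq_or_lt with h0 | h0
    · rw [← h0]; positivity
    · refine le_of_mul_le_mul_left ?_ h0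
      nlinarith
  nlinarith [mul_le_mul_of_nonneg_left h9 (specNorm_nonneg G⁻¹)]

/-- This is what makes a threshold of at least `2‖G⁻¹‖` harmless on the good event. -/
lemma specNorm_inv_le (hG : G.PosDef) (h : ∀ v, v ⬝ᵥ G *ᵥ v ≤ 2 * (v ⬝ᵥ A *ᵥ v)) :
    specNorm A⁻¹ ≤ 2 * specNorm G⁻¹ := by
  have hn := specNorm_nonneg G⁻¹
  refine specNorm_le (by positivity) fun t => ?_
  have hu := isUnit_det_of_le hG h
  have hA : A *ᵥ (A⁻¹ *ᵥ t) = t := by rw [mulVec_mulVec, mul_nonsing_inv _ hu, one_mulVec]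
  set x := A⁻¹ *ᵥ t
  have h1 := dotProduct_self_le_inv hG x
  have h2 := h x
  rw [hA] at h2
  have h3 := dotProduct_sq_le x t
  have h4 := dotProduct_self_nonneg' x
  have h5 := dotProduct_self_nonneg' t
  have h6 : x ⬝ᵥ x ≤ specNorm G⁻¹ * (2 * (x ⬝ᵥ t)) :=
    h1.trans (mul_le_mul_of_nonneg_left h2 hn)
  rcases h4.eq_or_lt with h0 | h0
  · rw [← h0]; positivity
  · refine le_of_mul_le_mul_left ?_ h0
    have h7 : (x ⬝ᵥ x) ^ 2 ≤ (specNorm G⁻¹ * (2 * (x ⬝ᵥ t))) ^ 2 :=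
      pow_le_pow_left₀ h4 h6 2
    nlinarith [mul_le_mul_of_nonneg_left h3 (sq_nonneg (2 * specNorm G⁻¹))]

end LinearAlgebra

/-! ### The weighted norm and the Galerkin bias. -/

section WeightedNorm

variable {H : Type*} [NormedAddCommGroup H] [InnerProductSpace ℝ H]
variable (ψ : HilbertBasis ℕ ℝ H) (ω : ℕ → ℝ)

lemma coeffs_add (m : ℕ) (f g : H) : coeffs ψ m (f + g) = coeffs ψ m f + coeffs ψ m g := by
  ext; simp [coeffs, inner_add_left]

lemma coeffs_smul (m : ℕ) (c : ℝ) (f : H) : coeffs ψ m (c • f) = c • coeffs ψ m f := by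
  ext; simp [coeffs, inner_smul_left]

lemma coeffs_sum (m : ℕ) {ι : Type*} (s : Finset ι) (f : ι → H) :
    coeffs ψ m (∑ i ∈ s, f i) = ∑ i ∈ s, coeffs ψ m (f i) := by
  ext; simp [coeffs, sum_inner]

lemma synth_add (m : ℕ) (v w : Fin m → ℝ) : synth ψ m (v + w) = synth ψ m v + synth ψ m w := by
  simp [synth, add_smul, Finset.sum_add_distrib]

lemma synth_smul (m : ℕ) (c : ℝ) (v : Fin m → ℝ) : synth ψ m (c • v) = c • synth ψ m v := by
  simp [synth, mul_smul, Finset.smul_sum]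

lemma inner_synth (m : ℕ) (v : Fin m → ℝ) (f : H) :
    inner ℝ (synth ψ m v) f = v ⬝ᵥ coeffs ψ m f := by
  simp [synth, sum_inner, inner_smul_left, coeffs, dotProduct, real_inner_comm]

lemma inner_synth_basis (m : ℕ) (v : Fin m → ℝ) (j : ℕ) :
    inner ℝ (synth ψ m v) (ψ j) = if h : j < m then v ⟨j, h⟩ else 0 := by
  rw [inner_synth]
  simp only [dotProduct, coeffs]
  have key := orthonormal_iff_ite.1 ψ.orthonormal j
  simp only [key]
  split_ifs with h
  · rw [Finset.sum_eq_single ⟨j, h⟩]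
    · simp
    · intro b _ hb
      have : j ≠ (b : ℕ) := fun hh => hb (Fin.ext hh.symm)
      simp [this]
    · simp
  · refine Finset.sum_eq_zero fun b _ => ?_
    have : j ≠ (b : ℕ) := fun hh => h (hh ▸ b.2)
    simp [this]

lemma coeffs_synth (m : ℕ) (v : Fin m → ℝ) : coeffs ψ m (synth ψ m v) = v := by
  ext j; simp [coeffs, inner_synth_basis]

lemma coeffs_proj (m : ℕ) (f : H) : coeffs ψ m (proj ψ m f) = coeffs ψ m f :=
  coeffs_synth ψ m _

lemma proj_smul (m : ℕ) (c : ℝ) (f : H) : proj ψ m (c • f) = c • proj ψ m f := by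
  simp [proj, coeffs_smul, synth_smul]

lemma projPerp_smul (m : ℕ) (c : ℝ) (f : H) : projPerp ψ m (c • f) = c • projPerp ψ m f := by
  simp [projPerp, proj_smul, smul_sub]

lemma projPerp_projPerp (m : ℕ) (f : H) : projPerp ψ m (projPerp ψ m f) = projPerp ψ m f := by
  have : coeffs ψ m (f - proj ψ m f) = 0 := by
    rw [sub_eq_add_neg, ← neg_one_smul ℝ, coeffs_add, coeffs_smul, coeffs_proj]; simp
  simp [projPerp, proj, synth] at this ⊢
  simp [this]

lemma inner_projPerp_basis (m : ℕ) (f : H) (j : ℕ) :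
    inner ℝ (projPerp ψ m f) (ψ j) = if j < m then 0 else inner ℝ f (ψ j) := by
  rw [projPerp, inner_sub_left, proj, inner_synth_basis]
  split_ifs <;> simp [coeffs]

lemma wnormSq_smul (c : ℝ) (f : H) :
    wnormSq ψ ω (c • f) = ENNReal.ofReal (c ^ 2) * wnormSq ψ ω f := by
  rw [wnormSq, wnormSq, ← ENNReal.tsum_mul_left]
  refine tsum_congr fun j => ?_
  rw [← ENNReal.ofReal_mul (sq_nonneg c), real_inner_smul_left]
  congr 1; ring

lemma wnormSq_neg (f : H) : wnormSq ψ ω (-f) = wnormSq ψ ω f := by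
  simp [wnormSq]

variable {ω}

lemma wnormSq_add_le (hω : ∀ j, 0 < ω j) (f g : H) :
    wnormSq ψ ω (f + g) ≤ 2 * wnormSq ψ ω f + 2 * wnormSq ψ ω g := by
  simp only [wnormSq]
  rw [← ENNReal.tsum_mul_left, ← ENNReal.tsum_mul_left, ← ENNReal.tsum_add]
  refine ENNReal.tsum_le_tsum fun j => ?_
  have h := (hω j).le
  rw [← ENNReal.ofReal_ofNat 2, ← ENNReal.ofReal_mul (by norm_num),
    ← ENNReal.ofReal_mul (by norm_num), ← ENNReal.ofReal_add (by positivity) (by positivity)]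
  refine ENNReal.ofReal_le_ofReal ?_
  rw [inner_add_left]
  nlinarith [mul_nonneg h (sq_nonneg (inner ℝ f (ψ j) - inner ℝ g (ψ j)))]

lemma wnormSq_synth_le (hω : ∀ j, 0 < ω j) (m : ℕ) (v : Fin m → ℝ) :
    wnormSq ψ ω (synth ψ m v) ≤ ENNReal.ofReal ((⨆ j : Fin m, ω j) * (v ⬝ᵥ v)) := by
  have h0 : ∀ j ∉ Finset.range m,
      ENNReal.ofReal (ω j * (inner ℝ (synth ψ m v) (ψ j)) ^ 2) = 0 := by
    intro j hj
    simp only [Finset.mem_range] at hj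
    simp [inner_synth_basis, hj]
  rw [wnormSq, tsum_eq_sum h0, ← Fin.sum_univ_eq_sum_range
    (fun j => ENNReal.ofReal (ω j * (inner ℝ (synth ψ m v) (ψ j)) ^ 2)),
    ← ENNReal.ofReal_sum_of_nonneg (fun (j : Fin m) _ =>
      mul_nonneg (hω j).le (sq_nonneg (inner ℝ (synth ψ m v) (ψ j))))]
  refine ENNReal.ofReal_le_ofReal ?_
  rw [dotProduct, Finset.mul_sum]
  refine Finset.sum_le_sum fun j _ => ?_
  simp only [inner_synth_basis, Fin.is_lt, dif_pos, Fin.eta, sq]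
  refine mul_le_mul_of_nonneg_right ?_ (mul_self_nonneg _)
  exact le_ciSup (f := fun j : Fin m => ω j) (Set.finite_range _).bddAbove j

lemma wnormSq_eq_zero (hω : ∀ j, 0 < ω j) {f : H} (h : wnormSq ψ ω f = 0) : f = 0 := by
  rw [wnormSq, ENNReal.tsum_eq_zero] at h
  refine ψ.repr.map_eq_zero_iff.1 ?_
  ext j
  have := h j
  rw [ENNReal.ofReal_eq_zero] at this
  have h2 : inner ℝ f (ψ j) ^ 2 ≤ 0 := by nlinarith [hω j]
  have h3 : inner ℝ f (ψ j) = 0 := by nlinarith [sq_nonneg (inner ℝ f (ψ j))]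
  rw [ψ.repr_apply_apply, real_inner_comm, h3]
  rfl

lemma wnorm_sq (f : H) : wnorm ψ ω f ^ 2 = wnormSq ψ ω f := by
  rw [wnorm, ← ENNReal.rpow_natCast, ← ENNReal.rpow_mul]
  norm_num

/-- Rescaling to the unit sphere needs only homogeneity of `K`. Positive weights make the norm
definite, so a vector of norm zero is `0`. -/
lemma wnormSq_apply_le (hω : ∀ j, 0 < ω j) {K : H → H} (hK : ∀ (c : ℝ) f, K (c • f) = c • K f)
    {f : H} (hf : wnormSq ψ ω f < ∞) :
    wnormSq ψ ω (K f) ≤ wopNorm ψ ω K ^ 2 * wnormSq ψ ω f := by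
  by_cases h0 : wnormSq ψ ω f = 0
  · have hf0 := wnormSq_eq_zero ψ hω h0
    have : K 0 = 0 := by
      have := hK 0 0
      rwa [zero_smul, zero_smul] at this
    rw [hf0, this]; simp [wnormSq]
  set a := (wnormSq ψ ω f).toReal with ha
  have ha0 : 0 < a := ENNReal.toReal_pos h0 hf.ne
  have haf : wnormSq ψ ω f = ENNReal.ofReal a := (ENNReal.ofReal_toReal hf.ne).symm
  have hc : ((Real.sqrt a)⁻¹) ^ 2 = a⁻¹ := by rw [inv_pow, Real.sq_sqrt ha0.le]
  have h1 : wnorm ψ ω ((Real.sqrt a)⁻¹ • f) = 1 := by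
    rw [wnorm, wnormSq_smul, hc, haf, ← ENNReal.ofReal_mul (by positivity),
      inv_mul_cancel₀ ha0.ne']
    simp
  have h2 : wnorm ψ ω (K ((Real.sqrt a)⁻¹ • f)) ≤ wopNorm ψ ω K :=
    le_iSup₂ (f := fun (f : H) (_ : wnorm ψ ω f = 1) => wnorm ψ ω (K f)) _ h1
  have h3 : ENNReal.ofReal a⁻¹ * wnormSq ψ ω (K f) ≤ wopNorm ψ ω K ^ 2 := by
    rw [← hc, ← wnormSq_smul, ← hK, ← wnorm_sq]
    gcongr
  calc wnormSq ψ ω (K f) = (ENNReal.ofReal a⁻¹ * wnormSq ψ ω (K f)) * ENNReal.ofReal a := by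
        rw [mul_comm, ← mul_assoc, ← ENNReal.ofReal_mul ha0.le, mul_inv_cancel₀ ha0.ne']
        simp
    _ ≤ wopNorm ψ ω K ^ 2 * wnormSq ψ ω f := by rw [haf]; gcongr

lemma tendsto_wnormSq_projPerp {f : H} (hf : wnormSq ψ ω f < ∞) :
    Tendsto (fun k => wnormSq ψ ω (projPerp ψ k f)) atTop (𝓝 0) := by
  refine (ENNReal.tendsto_sum_nat_add
    (fun j => ENNReal.ofReal (ω j * (inner ℝ f (ψ j)) ^ 2)) hf.ne).congr fun k => ?_
  rw [wnormSq, ← ENNReal.summable.sum_add_tsum_nat_add' (k := k)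
    (f := fun j => ENNReal.ofReal (ω j * (inner ℝ (projPerp ψ k f) (ψ j)) ^ 2))]
  rw [Finset.sum_eq_zero, zero_add]
  · refine tsum_congr fun j => ?_
    simp [inner_projPerp_basis]
  · intro j hj
    simp [inner_projPerp_basis, Finset.mem_range.1 hj]

lemma truncMatrix_mulVec (m : ℕ) (K : H →L[ℝ] H) (v : Fin m → ℝ) :
    Matrix.mulVec (truncMatrix ψ m K) v = coeffs ψ m (K (synth ψ m v)) := by
  ext i
  simp [truncMatrix, Matrix.mulVec, dotProduct, coeffs, synth, sum_inner, real_inner_smul_left,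
    mul_comm]

/-- The coefficients of the projection onto the first `m` basis functions with respect to the
inner product induced by `K`. -/
noncomputable def galerkinCoeffs (m : ℕ) (K : H →L[ℝ] H) (f : H) : Fin m → ℝ :=
  Matrix.mulVec (truncMatrix ψ m K)⁻¹ (coeffs ψ m (K f))

lemma truncMatrix_mulVec_galerkinCoeffs {m : ℕ} {K : H →L[ℝ] H}
    (hK : IsUnit (truncMatrix ψ m K).det) (f : H) :
    Matrix.mulVec (truncMatrix ψ m K) (galerkinCoeffs ψ m K f) = coeffs ψ m (K f) := by
  rw [galerkinCoeffs, Matrix.mulVec_mulVec, Matrix.mul_nonsing_inv _ hK, Matrix.one_mulVec]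

/-- Split `f` into head and tail: the head is reproduced exactly, so only the tail contributes. The
tail projection is written twice so that the operator is seen to act on the tail, and its norm
multiplies the norm of the tail rather than that of `f`. -/
lemma synth_galerkinCoeffs_sub {m : ℕ} {K : H →L[ℝ] H}
    (hK : IsUnit (truncMatrix ψ m K).det) (f : H) :
    synth ψ m (galerkinCoeffs ψ m K f) - f
      = truncInv ψ m K (proj ψ m (K (projPerp ψ m (projPerp ψ m f)))) + -projPerp ψ m f := by
  have h : galerkinCoeffs ψ m K f = coeffs ψ m f
      + Matrix.mulVec (truncMatrix ψ m K)⁻¹ (coeffs ψ m (K (projPerp ψ m f))) := by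
    have h1 : coeffs ψ m (K f) = Matrix.mulVec (truncMatrix ψ m K) (coeffs ψ m f)
        + coeffs ψ m (K (projPerp ψ m f)) := by
      rw [truncMatrix_mulVec, ← coeffs_add, ← map_add]
      congr 2
      simp [projPerp, proj]
    rw [galerkinCoeffs, h1, Matrix.mulVec_add, Matrix.mulVec_mulVec,
      Matrix.nonsing_inv_mul _ hK, Matrix.one_mulVec]
  rw [h, synth_add, projPerp_projPerp, truncInv, coeffs_proj]
  simp only [projPerp, proj]
  abel

lemma tendsto_wnormSq_synth_galerkinCoeffs_sub (hω : ∀ j, 0 < ω j) {K : H →L[ℝ] H}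
    (hK : ∀ k, IsUnit (truncMatrix ψ k K).det)
    (hbd : ⨆ k : ℕ, wopNorm ψ ω (fun f =>
      truncInv ψ k K (proj ψ k (K (projPerp ψ k f)))) < ∞) {f : H} (hf : wnormSq ψ ω f < ∞) :
    Tendsto (fun k => wnormSq ψ ω (synth ψ k (galerkinCoeffs ψ k K f) - f)) atTop (𝓝 0) := by
  set C := ⨆ k : ℕ, wopNorm ψ ω (fun f => truncInv ψ k K (proj ψ k (K (projPerp ψ k f))))
  have h0 := tendsto_wnormSq_projPerp ψ hf
  have hC : 2 * C ^ 2 + 2 ≠ ∞ := by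
    have : C ^ 2 < ∞ := ENNReal.pow_lt_top hbd
    finiteness
  have h1 : Tendsto (fun k => (2 * C ^ 2 + 2) * wnormSq ψ ω (projPerp ψ k f)) atTop (𝓝 0) := by
    simpa using ENNReal.Tendsto.const_mul h0 (Or.inr hC)
  refine tendsto_of_tendsto_of_tendsto_of_le_of_le' tendsto_const_nhds h1
    (Eventually.of_forall fun _ => zero_le) ?_
  filter_upwards [h0.eventually_lt_const (u := ∞) (by simp)] with k hk
  rw [synth_galerkinCoeffs_sub ψ (hK k)]
  refine (wnormSq_add_le ψ hω _ _).trans ?_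
  rw [wnormSq_neg]
  have h2 := wnormSq_apply_le ψ hω
    (K := fun f => truncInv ψ k K (proj ψ k (K (projPerp ψ k f)))) (fun c f => by
      simp [projPerp_smul, proj_smul, truncInv, coeffs_smul, Matrix.mulVec_smul, synth_smul]) hk
  have h3 : wopNorm ψ ω (fun f => truncInv ψ k K (proj ψ k (K (projPerp ψ k f)))) ≤ C :=
    le_iSup (fun k => wopNorm ψ ω (fun f => truncInv ψ k K (proj ψ k (K (projPerp ψ k f))))) k
  calc _ ≤ 2 * (C ^ 2 * wnormSq ψ ω (projPerp ψ k f)) + 2 * wnormSq ψ ω (projPerp ψ k f) := by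
        gcongr
        refine h2.trans ?_
        gcongr
    _ = _ := by ring

end WeightedNorm

/-! ### Empirical matrices and the score vector. -/

section Empirical

open Matrix

variable {H : Type*} [NormedAddCommGroup H] [InnerProductSpace ℝ H]
variable (ψ : HilbertBasis ℕ ℝ H) {m : ℕ}

lemma truncMatrix_empCov (n : ℕ) (x : ℕ → H) (v : Fin m → ℝ) :
    truncMatrix ψ m (empCov n x) *ᵥ v
      = (n : ℝ)⁻¹ • ∑ i ∈ Finset.range n, (v ⬝ᵥ coeffs ψ m (x i)) • coeffs ψ m (x i) := by
  ext j
  simp only [truncMatrix, empCov, mulVec, dotProduct, of_apply, real_inner_smul_left, sum_inner,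
    Pi.smul_apply, smul_eq_mul, Finset.sum_apply, Finset.mul_sum, Finset.sum_mul, coeffs]
  rw [Finset.sum_comm]
  refine Finset.sum_congr rfl fun i _ => Finset.sum_congr rfl fun k _ => ?_
  ring

lemma dotProduct_truncMatrix_empCov (n : ℕ) (x : ℕ → H) (v : Fin m → ℝ) :
    v ⬝ᵥ truncMatrix ψ m (empCov n x) *ᵥ v
      = (n : ℝ)⁻¹ * ∑ i ∈ Finset.range n, (v ⬝ᵥ coeffs ψ m (x i)) ^ 2 := by
  rw [truncMatrix_empCov, dotProduct_smul, dotProduct_sum, smul_eq_mul]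
  simp [sq]

/-- The average of the residuals `yᵢ - ⟨b, xᵢ⟩` times the regressors. -/
noncomputable def score (n : ℕ) (b : Fin m → ℝ) (y : ℕ → ℝ) (x : ℕ → Fin m → ℝ) : Fin m → ℝ :=
  (n : ℝ)⁻¹ • ∑ i ∈ Finset.range n, (y i - b ⬝ᵥ x i) • x i

lemma coeffs_empG_sub (n : ℕ) (b : Fin m → ℝ) (y : ℕ → ℝ) (x : ℕ → H) :
    coeffs ψ m (empG n y x) - truncMatrix ψ m (empCov n x) *ᵥ b
      = score n b y (fun i => coeffs ψ m (x i)) := by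
  rw [truncMatrix_empCov, empG, coeffs_smul, coeffs_sum, score, ← smul_sub,
    ← Finset.sum_sub_distrib]
  simp [coeffs_smul, sub_smul]

/-- All cancellation is given up here. The bound serves only on the rare event, where separate
contributions are needed for decoupling. -/
lemma score_dotProduct_self_le (n : ℕ) (b : Fin m → ℝ) (y : ℕ → ℝ) (x : ℕ → Fin m → ℝ) :
    score n b y x ⬝ᵥ score n b y x
      ≤ (n : ℝ)⁻¹ * ∑ i ∈ Finset.range n, (y i - b ⬝ᵥ x i) ^ 2 * (x i ⬝ᵥ x i) := by
  rcases Nat.eq_zero_or_pos n with rfl | hn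
  · simp [score]
  have hn' : (0 : ℝ) < n := by exact_mod_cast hn
  simp only [score, dotProduct, Finset.mul_sum]
  rw [Finset.sum_comm]
  refine Finset.sum_le_sum fun j _ => ?_
  simp only [Pi.smul_apply, Finset.sum_apply, smul_eq_mul]
  have h := sq_sum_le_card_mul_sum_sq (s := Finset.range n)
    (f := fun i => (y i - ∑ k, b k * x i k) * x i j)
  rw [Finset.card_range] at h
  have h2 : (n : ℝ)⁻¹ * ∑ i ∈ Finset.range n, ((y i - ∑ k, b k * x i k) * x i j) ^ 2
      = ∑ i ∈ Finset.range n,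
        (n : ℝ)⁻¹ * ((y i - ∑ k, b k * x i k) ^ 2 * (x i j * x i j)) := by
    rw [Finset.mul_sum]
    exact Finset.sum_congr rfl fun i _ => by ring
  rw [← h2]
  set s := ∑ i ∈ Finset.range n, (y i - ∑ k, b k * x i k) * x i j
  calc (n : ℝ)⁻¹ * s * ((n : ℝ)⁻¹ * s) = (n : ℝ)⁻¹ * (n : ℝ)⁻¹ * s ^ 2 := by ring
    _ ≤ (n : ℝ)⁻¹ * (n : ℝ)⁻¹ * (n * ∑ i ∈ Finset.range n,
          ((y i - ∑ k, b k * x i k) * x i j) ^ 2) := by gcongr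
    _ = _ := by field_simp

end Empirical

/-! ### Inequalities for fourth moments. -/

section FourthMoments

variable {E : Type*} [MeasurableSpace E] {μ : Measure E}

lemma memLp_two_mul {f g : E → ℝ} (hf : MemLp f 4 μ) (hg : MemLp g 4 μ) :
    MemLp (fun e => f e * g e) 2 μ := by
  have : ENNReal.HolderTriple 4 4 2 := ⟨by
    rw [← ENNReal.toReal_eq_toReal_iff' (by simp) (by simp), ENNReal.toReal_add (by simp) (by simp)]
    norm_num⟩
  exact hg.mul hf

lemma integrable_pow_four {f : E → ℝ} (hf : MemLp f 4 μ) : Integrable (fun e => f e ^ 4) μ := by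
  have := (memLp_two_mul hf hf).integrable_sq
  refine this.congr (Eventually.of_forall fun e => ?_)
  ring

lemma memLp_four_of_lintegral_le {f : E → ℝ} (hf : AEStronglyMeasurable f μ) {η : ℝ}
    (hη : 0 ≤ η) (h : ∫⁻ e, ENNReal.ofReal (|f e| ^ 4) ∂μ ≤ ENNReal.ofReal η) :
    MemLp f 4 μ ∧ ∫ e, f e ^ 4 ∂μ ≤ η := by
  have h4 : ∀ e, |f e| ^ 4 = f e ^ 4 := fun e => (by decide : Even 4).pow_abs _
  simp only [h4] at h
  have h0 : 0 ≤ᵐ[μ] fun e => f e ^ 4 := Eventually.of_forall fun e => by positivity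
  have hi : Integrable (fun e => f e ^ 4) μ := by
    refine ⟨hf.pow 4, ?_⟩
    rw [hasFiniteIntegral_iff_ofReal h0]
    exact h.trans_lt ENNReal.ofReal_lt_top
  refine ⟨?_, ?_⟩
  · have := (integrable_norm_rpow_iff (p := 4) hf (by norm_num) (by norm_num)).1 (by
      refine hi.congr (Eventually.of_forall fun e => ?_)
      simp [h4])
    exact this
  · rw [integral_eq_lintegral_of_nonneg_ae h0 (hf.pow 4)]
    exact ENNReal.toReal_le_of_le_ofReal hη h

/-- Weighted arithmetic-geometric mean. The free `c` balances moments of different size: if the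
first is `O(l²)` and the second `O(1)`, the choice `c = l` gives `O(l)`. -/
lemma integral_sq_mul_sq_le {f g : E → ℝ} (hf : MemLp f 4 μ) (hg : MemLp g 4 μ) {c : ℝ}
    (hc : 0 < c) :
    ∫ e, (f e * g e) ^ 2 ∂μ ≤ ((∫ e, f e ^ 4 ∂μ) / c + c * ∫ e, g e ^ 4 ∂μ) / 2 := by
  rw [← integral_div, ← integral_const_mul, ← integral_add, ← integral_div]
  · refine integral_mono (memLp_two_mul hf hg).integrable_sq
      ((((integrable_pow_four hf).div_const c).add
        ((integrable_pow_four hg).const_mul c)).div_const 2) fun e => ?_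
    have h : 0 ≤ c * (f e ^ 2 / c - g e ^ 2) ^ 2 := by positivity
    have h2 : c * (f e ^ 2 / c - g e ^ 2) ^ 2
        = f e ^ 4 / c + c * g e ^ 4 - 2 * (f e * g e) ^ 2 := by
      field_simp
      ring
    simp only
    linarith
  · exact (integrable_pow_four hf).div_const c
  · exact (integrable_pow_four hg).const_mul c

/-- Jensen's inequality for the fourth power and nonnegative weights. -/
lemma sum_mul_pow_four_le {ι : Type*} (s : Finset ι) {a : ι → ℝ} (ha : ∀ i, 0 ≤ a i)
    (y : ι → ℝ) : (∑ i ∈ s, a i * y i) ^ 4 ≤ (∑ i ∈ s, a i) ^ 3 * ∑ i ∈ s, a i * y i ^ 4 := by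
  have h : ∀ y : ι → ℝ, (∑ i ∈ s, a i * y i) ^ 2
      ≤ (∑ i ∈ s, a i) * ∑ i ∈ s, a i * y i ^ 2 := fun y =>
    Finset.sum_sq_le_sum_mul_sum_of_sq_le_mul s (fun i _ => ha i)
      (fun i _ => mul_nonneg (ha i) (sq_nonneg _)) fun i _ => le_of_eq (by ring)
  have h1 := h y
  have h2 := h fun i => y i ^ 2
  have h3 : 0 ≤ ∑ i ∈ s, a i := Finset.sum_nonneg fun i _ => ha i
  calc (∑ i ∈ s, a i * y i) ^ 4 = ((∑ i ∈ s, a i * y i) ^ 2) ^ 2 := by ring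
    _ ≤ ((∑ i ∈ s, a i) * ∑ i ∈ s, a i * y i ^ 2) ^ 2 := by gcongr
    _ = (∑ i ∈ s, a i) ^ 2 * (∑ i ∈ s, a i * y i ^ 2) ^ 2 := by ring
    _ ≤ (∑ i ∈ s, a i) ^ 2 * ((∑ i ∈ s, a i) * ∑ i ∈ s, a i * (y i ^ 2) ^ 2) := by gcongr
    _ = (∑ i ∈ s, a i) ^ 3 * ∑ i ∈ s, a i * y i ^ 4 := by
      simp only [← pow_mul]; ring

end FourthMoments

/-! ### Chernoff bounds, decoupling and variances of averages. -/

section Independence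

variable {Ω E : Type*} [MeasurableSpace Ω] [MeasurableSpace E] {P : Measure Ω}
  {μ : Measure E} {D : ℕ → Ω → E}

/-- Uses `exp x ≤ 1 + x + x²` for `|x| ≤ 1`, then `1 + y ≤ exp y` after integration; the linear term
cancels against the centring. -/
lemma mgf_sub_integral_le [IsProbabilityMeasure μ] (hD : ∀ i, Measurable (D i)) (hlaw : ∀ i, P.map (D i) = μ)
    {w : E → ℝ} (hw : Measurable w) {R v l : ℝ} (hR : ∀ e, |w e| ≤ R)
    (hv : ∫ e, w e ^ 2 ∂μ ≤ v) (hl : 0 ≤ l) (hlR : l * R ≤ 1) (i : ℕ) :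
    mgf (fun a => w (D i a) - ∫ e, w e ∂μ) P l ≤ Real.exp (l ^ 2 * v) := by
  set c := ∫ e, w e ∂μ
  have hint : Integrable w μ := Integrable.of_bound hw.aestronglyMeasurable R
    (Eventually.of_forall hR)
  have hint2 : Integrable (fun e => w e ^ 2) μ :=
    Integrable.of_bound (hw.pow_const 2).aestronglyMeasurable (R ^ 2)
      (Eventually.of_forall fun e => by
        rw [Real.norm_eq_abs, abs_pow]; gcongr; exact hR e)
  have hle : ∀ e, |l * w e| ≤ 1 := fun e => by
    rw [abs_mul, abs_of_nonneg hl]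
    exact (mul_le_mul_of_nonneg_left (hR e) hl).trans hlR
  have h1 : mgf (fun a => w (D i a) - c) P l = ∫ e, Real.exp (l * (w e - c)) ∂μ := by
    rw [mgf, ← hlaw i, integral_map (hD i).aemeasurable]
    exact (by fun_prop : Measurable fun e => Real.exp (l * (w e - c))).aestronglyMeasurable
  rw [h1]
  have h2 : ∀ e, Real.exp (l * (w e - c))
      ≤ Real.exp (-(l * c)) * (1 + l * w e + l ^ 2 * w e ^ 2) := fun e => by
    rw [mul_sub, sub_eq_neg_add, Real.exp_add]
    gcongr
    have := Real.abs_exp_sub_one_sub_id_le (hle e)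
    nlinarith [abs_le.1 this]
  have hi3 : Integrable (fun e => 1 + l * w e + l ^ 2 * w e ^ 2) μ :=
    ((integrable_const 1).add (hint.const_mul l)).add (hint2.const_mul _)
  calc ∫ e, Real.exp (l * (w e - c)) ∂μ
      ≤ ∫ e, Real.exp (-(l * c)) * (1 + l * w e + l ^ 2 * w e ^ 2) ∂μ :=
        integral_mono_of_nonneg (Eventually.of_forall fun e => (Real.exp_pos _).le)
          (hi3.const_mul _) (Eventually.of_forall h2)
    _ = Real.exp (-(l * c)) * (1 + l * c + l ^ 2 * ∫ e, w e ^ 2 ∂μ) := by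
        rw [integral_const_mul, integral_add, integral_add, integral_const_mul,
          integral_const_mul]
        · simp [c]
        · exact integrable_const 1
        · exact hint.const_mul l
        · exact (integrable_const 1).add (hint.const_mul l)
        · exact hint2.const_mul _
    _ ≤ Real.exp (-(l * c)) * Real.exp (l * c + l ^ 2 * v) := by
        gcongr
        have := Real.add_one_le_exp (l * c + l ^ 2 * v)
        nlinarith [mul_le_mul_of_nonneg_left hv (sq_nonneg l)]
    _ = Real.exp (l ^ 2 * v) := by rw [← Real.exp_add]; congr 1; ring

lemma measure_sum_ge_le [IsProbabilityMeasure P] [IsProbabilityMeasure μ]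
    (hD : ∀ i, Measurable (D i)) (hind : iIndepFun D P)
    (hlaw : ∀ i, P.map (D i) = μ)
    {w : E → ℝ} (hw : Measurable w) {R v l : ℝ} (hR : ∀ e, |w e| ≤ R)
    (hv : ∫ e, w e ^ 2 ∂μ ≤ v) (hl : 0 ≤ l) (hlR : l * R ≤ 1) (t : Finset ℕ) (a : ℝ) :
    P {x | a ≤ ∑ i ∈ t, (w (D i x) - ∫ e, w e ∂μ)}
      ≤ ENNReal.ofReal (Real.exp (t.card * (l ^ 2 * v) - l * a)) := by
  set c := ∫ e, w e ∂μ
  have hX : ∀ i, Measurable fun x => w (D i x) - c := fun i =>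
    (hw.comp (hD i)).sub_const c
  have hindX : iIndepFun (fun i x => w (D i x) - c) P :=
    hind.comp (fun _ e => w e - c) fun _ => hw.sub_const c
  have hmgf := hindX.mgf_sum (t := l) hX t
  have hsum : (∑ i ∈ t, fun x => w (D i x) - c) = fun x => ∑ i ∈ t, (w (D i x) - c) := by
    ext; simp
  rw [hsum] at hmgf
  have hint : Integrable (fun x => Real.exp (l * ∑ i ∈ t, (w (D i x) - c))) P := by
    refine Integrable.of_bound (C := Real.exp (l * ∑ _i ∈ t, (R + |c|)))
      (((Finset.measurable_sum _ fun i _ => hX i).const_mul l).exp.aestronglyMeasurable)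
      (Eventually.of_forall fun x => ?_)
    rw [Real.norm_eq_abs, Real.abs_exp]
    gcongr with i
    have := hR (D i x)
    have := le_abs_self (w (D i x))
    have := neg_abs_le c
    linarith
  have h := measure_ge_le_exp_mul_mgf a hl hint
  rw [← ofReal_measureReal]
  refine ENNReal.ofReal_le_ofReal (h.trans ?_)
  rw [hmgf, sub_eq_neg_add, Real.exp_add, neg_mul, Real.exp_nat_mul, ← Finset.prod_const]
  gcongr
  · exact fun _ _ => mgf_nonneg
  · exact mgf_sub_integral_le hD hlaw hw hR hv hl hlR _

/-- The index `i` lies outside `t`, so `D i` is independent of the event. The exact factorization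
asks for no moment of `f` beyond the first. -/
lemma lintegral_comp_mul_indicator (hD : ∀ i, Measurable (D i)) (hind : iIndepFun D P)
    (hlaw : ∀ i, P.map (D i) = μ) {w : E → ℝ} (hw : Measurable w) {f : E → ℝ≥0∞}
    (hf : Measurable f) {t : Finset ℕ} {i : ℕ} (hi : i ∉ t) (a : ℝ) :
    ∫⁻ x, f (D i x) * {x | a ≤ ∑ k ∈ t, w (D k x)}.indicator 1 x ∂P
      = (∫⁻ e, f e ∂μ) * P {x | a ≤ ∑ k ∈ t, w (D k x)} := by
  have h := hind.indepFun_finset {i} t (by simpa using hi) hD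
  have hset : MeasurableSet {b : t → E | a ≤ ∑ k, w (b k)} :=
    measurableSet_le measurable_const (by fun_prop)
  have hset2 : MeasurableSet {x | a ≤ ∑ k ∈ t, w (D k x)} :=
    measurableSet_le measurable_const (by fun_prop)
  have h2 := h.comp (φ := fun b : ({i} : Finset ℕ) → E => f (b ⟨i, by simp⟩))
    (ψ := {b : t → E | a ≤ ∑ k, w (b k)}.indicator (1 : (t → E) → ℝ≥0∞))
    (by fun_prop) (measurable_one.indicator hset)
  have h3 : ({b : t → E | a ≤ ∑ k, w (b k)}.indicator (1 : (t → E) → ℝ≥0∞))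
      ∘ (fun x (k : t) => D k x) = {x | a ≤ ∑ k ∈ t, w (D k x)}.indicator 1 := by
    ext x
    have : ∑ k : t, w (D k x) = ∑ k ∈ t, w (D k x) :=
      Finset.sum_coe_sort t fun k => w (D k x)
    simp only [Set.indicator, Function.comp_apply, Set.mem_ofPred_eq, this]
    rfl
  rw [h3] at h2
  have h4 := lintegral_mul_eq_lintegral_mul_lintegral_of_indepFun (hf.comp (hD i))
    (measurable_one.indicator hset2) h2
  refine h4.trans ?_
  rw [lintegral_indicator_one hset2, ← hlaw i, lintegral_map hf (hD i)]
  rfl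

lemma lintegral_comp_mul_indicator_exists_le {κ : Type*} [Fintype κ] [IsProbabilityMeasure P] [IsProbabilityMeasure μ]
    (hD : ∀ i, Measurable (D i)) (hind : iIndepFun D P)
    (hlaw : ∀ i, P.map (D i) = μ) {w : κ → E → ℝ} (hw : ∀ k, Measurable (w k)) {R v l : ℝ}
    (hR : ∀ k e, |w k e| ≤ R) (hv : ∀ k, ∫ e, w k e ^ 2 ∂μ ≤ v) (hl : 0 ≤ l) (hlR : l * R ≤ 1)
    {f : E → ℝ≥0∞} (hf : Measurable f) {t : Finset ℕ} {i : ℕ} (hi : i ∉ t) (a : ℝ) :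
    ∫⁻ x, f (D i x) *
        {x | ∃ k, a ≤ ∑ j ∈ t, (w k (D j x) - ∫ e, w k e ∂μ)}.indicator 1 x ∂P
      ≤ (∫⁻ e, f e ∂μ) * ENNReal.ofReal
        (Fintype.card κ * Real.exp (t.card * (l ^ 2 * v) - l * a)) := by
  calc _ ≤ ∫⁻ x, ∑ k, f (D i x) *
        {x | a ≤ ∑ j ∈ t, (w k (D j x) - ∫ e, w k e ∂μ)}.indicator 1 x ∂P := by
        refine lintegral_mono fun x => ?_
        by_cases hx : ∃ k, a ≤ ∑ j ∈ t, (w k (D j x) - ∫ e, w k e ∂μ)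
        · obtain ⟨k, hk⟩ := hx
          refine le_trans ?_ (Finset.single_le_sum (fun _ _ => zero_le) (Finset.mem_univ k))
          rw [Set.indicator_of_mem (show x ∈ {x | ∃ k, a ≤ ∑ j ∈ t, (w k (D j x) - ∫ e, w k e ∂μ)}
            from ⟨k, hk⟩), Set.indicator_of_mem
            (show x ∈ {x | a ≤ ∑ j ∈ t, (w k (D j x) - ∫ e, w k e ∂μ)} from hk)]
        · rw [Set.indicator_of_notMem (by exact hx)]
          simp
    _ = ∑ k, ∫⁻ x, f (D i x) *
        {x | a ≤ ∑ j ∈ t, (w k (D j x) - ∫ e, w k e ∂μ)}.indicator 1 x ∂P := by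
        refine lintegral_finsetSum _ fun k _ => (hf.comp (hD i)).mul
          (measurable_one.indicator (measurableSet_le measurable_const ?_))
        exact Finset.measurable_sum _ fun j _ => ((hw k).comp (hD j)).sub_const _
    _ ≤ ∑ _k : κ, (∫⁻ e, f e ∂μ) *
        ENNReal.ofReal (Real.exp (t.card * (l ^ 2 * v) - l * a)) := by
        refine Finset.sum_le_sum fun k _ => ?_
        rw [lintegral_comp_mul_indicator hD hind hlaw ((hw k).sub_const (∫ e, w k e ∂μ)) hf hi a]
        gcongr
        exact measure_sum_ge_le hD hind hlaw (hw k) (hR k) (hv k) hl hlR t a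
    _ = _ := by
        rw [Finset.sum_const, Finset.card_univ, ENNReal.ofReal_mul (by positivity),
          ENNReal.ofReal_natCast, nsmul_eq_mul]
        ring

lemma lintegral_sq_average_eq [IsProbabilityMeasure P] (hD : ∀ i, Measurable (D i)) (hind : iIndepFun D P)
    (hlaw : ∀ i, P.map (D i) = μ) {q : E → ℝ} (hq : Measurable q) (hq2 : MemLp q 2 μ)
    (hq0 : ∫ e, q e ∂μ = 0) (n : ℕ) :
    ∫⁻ x, ENNReal.ofReal (((n : ℝ)⁻¹ * ∑ i ∈ Finset.range n, q (D i x)) ^ 2) ∂P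
      = ENNReal.ofReal ((n : ℝ)⁻¹ * ∫ e, q e ^ 2 ∂μ) := by
  have hX : ∀ i, MemLp (fun x => q (D i x)) 2 P := fun i => by
    have := hq2
    rw [← hlaw i] at this
    exact this.comp_of_map (hD i).aemeasurable
  have hEX : ∀ i, ∫ x, q (D i x) ∂P = 0 := fun i => by
    rw [← hq0, ← hlaw i, integral_map (hD i).aemeasurable hq.aestronglyMeasurable]
  have hEX2 : ∀ i, ∫ x, q (D i x) ^ 2 ∂P = ∫ e, q e ^ 2 ∂μ := fun i => by
    rw [← hlaw i, integral_map (hD i).aemeasurable (hq.pow_const 2).aestronglyMeasurable]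
  have hindX : iIndepFun (fun i x => q (D i x)) P := hind.comp (fun _ => q) fun _ => hq
  have hvar := IndepFun.variance_sum (s := Finset.range n) (fun i _ => hX i)
    (fun i _ j _ hij => hindX.indepFun hij)
  have hsum : (∑ i ∈ Finset.range n, fun x => q (D i x))
      = fun x => ∑ i ∈ Finset.range n, q (D i x) := by ext; simp
  have hmem : MemLp (fun x => ∑ i ∈ Finset.range n, q (D i x)) 2 P :=
    memLp_finsetSum _ fun i _ => hX i
  have h0 : ∫ x, ∑ i ∈ Finset.range n, q (D i x) ∂P = 0 := by
    rw [integral_finsetSum _ fun i _ => (hX i).integrable one_le_two]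
    simp [hEX]
  rw [hsum, variance_of_integral_eq_zero hmem.aestronglyMeasurable.aemeasurable h0] at hvar
  have hvi : ∀ i, Var[fun x => q (D i x); P] = ∫ e, q e ^ 2 ∂μ := fun i => by
    rw [variance_of_integral_eq_zero (hX i).aestronglyMeasurable.aemeasurable (hEX i), ← hEX2 i]
  simp only [hvi, Finset.sum_const, Finset.card_range, nsmul_eq_mul] at hvar
  have hi : Integrable (fun x => ((n : ℝ)⁻¹ * ∑ i ∈ Finset.range n, q (D i x)) ^ 2) P :=
    (hmem.const_mul _).integrable_sq
  rw [← ofReal_integral_eq_lintegral_ofReal hi (Eventually.of_forall fun x => sq_nonneg _)]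
  congr 1
  simp only [mul_pow]
  rw [integral_const_mul, hvar]
  rcases Nat.eq_zero_or_pos n with rfl | hn
  · simp
  · field_simp

end Independence

/-! ### Lower bounds for the empirical second moment matrix of isotropic vectors. -/

section Isotropic

open Matrix

variable {Ω E : Type*} {m : ℕ} {z : E → Fin m → ℝ}

/-- The signed entries of the matrix `z zᵀ`, truncated where `|z|² > R`. -/
noncomputable def truncEntry (z : E → Fin m → ℝ) (R : ℝ) (k : Fin m × Fin m × Bool) (e : E) : ℝ :=
  (if k.2.2 then 1 else -1) * if z e ⬝ᵥ z e ≤ R then z e k.1 * z e k.2.1 else 0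

lemma abs_mul_le_dotProduct_self (v : Fin m → ℝ) (j k : Fin m) : |v j * v k| ≤ v ⬝ᵥ v := by
  have h : ∀ j, v j ^ 2 ≤ v ⬝ᵥ v := fun j => by
    simp only [dotProduct, ← sq]
    exact Finset.single_le_sum (f := fun j => v j ^ 2) (fun _ _ => sq_nonneg _) (Finset.mem_univ j)
  rw [abs_le]
  constructor
  · nlinarith [h j, h k, sq_nonneg (v j + v k)]
  · nlinarith [h j, h k, sq_nonneg (v j - v k)]

lemma abs_truncEntry_le {R : ℝ} (hR : 0 ≤ R) (k : Fin m × Fin m × Bool) (e : E) :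
    |truncEntry z R k e| ≤ R := by
  have h := abs_mul_le_dotProduct_self (z e) k.1 k.2.1
  rw [truncEntry, abs_mul]
  have h1 : |(if k.2.2 then 1 else -1 : ℝ)| = 1 := by split_ifs <;> simp
  rw [h1, one_mul]
  split_ifs with h2
  · exact h.trans h2
  · simpa

lemma truncEntry_sq_le (R : ℝ) (k : Fin m × Fin m × Bool) (e : E) :
    truncEntry z R k e ^ 2 ≤ (z e k.1 * z e k.2.1) ^ 2 := by
  have h1 : (if k.2.2 then 1 else -1 : ℝ) ^ 2 = 1 := by split_ifs <;> simp
  rw [truncEntry, mul_pow, h1, one_mul]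
  split_ifs
  · rfl
  · simpa using sq_nonneg (z e k.1 * z e k.2.1)

lemma truncEntry_false (R : ℝ) (j k : Fin m) (e : E) :
    truncEntry z R (j, k, false) e = -truncEntry z R (j, k, true) e := by
  simp only [truncEntry, if_true, one_mul, Bool.false_eq_true, if_false, neg_mul]

lemma sum_mul_truncEntry (R : ℝ) (v : Fin m → ℝ) (e : E) :
    ∑ j, ∑ k, v j * v k * truncEntry z R (j, k, true) e
      = if z e ⬝ᵥ z e ≤ R then (v ⬝ᵥ z e) ^ 2 else 0 := by
  simp only [truncEntry, if_true, one_mul]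
  split_ifs
  · rw [sq, dotProduct, Finset.sum_mul_sum]
    exact Finset.sum_congr rfl fun j _ => Finset.sum_congr rfl fun k _ => by ring
  · simp

lemma sum_abs_sq_le (v : Fin m → ℝ) : (∑ j, |v j|) ^ 2 ≤ m * (v ⬝ᵥ v) := by
  have h := sq_sum_le_card_mul_sum_sq (s := Finset.univ) (f := fun j => |v j|)
  simpa [dotProduct, ← sq] using h

variable [MeasurableSpace Ω] [MeasurableSpace E] {P : Measure Ω}
  {μ : Measure E} {D : ℕ → Ω → E} {η : ℝ}

/-- The random vector `z` has second moment matrix `1` and fourth moments at most `η`. -/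
structure Isotropic (μ : Measure E) (z : E → Fin m → ℝ) (η : ℝ) : Prop where
  measurable : Measurable z
  memLp : ∀ j, MemLp (fun e => z e j) 4 μ
  fourth : ∀ j, ∫ e, z e j ^ 4 ∂μ ≤ η
  second : ∀ j k, ∫ e, z e j * z e k ∂μ = if j = k then 1 else 0

namespace Isotropic

variable (hz : Isotropic μ z η)
include hz

lemma measurable_apply (j : Fin m) : Measurable fun e => z e j :=
  (measurable_pi_apply j).comp hz.measurable

lemma measurable_dotProduct (v : Fin m → ℝ) : Measurable fun e => v ⬝ᵥ z e :=
  Finset.measurable_sum _ fun j _ => (hz.measurable_apply j).const_mul (v j)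

lemma measurable_dotProduct_self : Measurable fun e => z e ⬝ᵥ z e :=
  Finset.measurable_sum _ fun j _ => (hz.measurable_apply j).mul (hz.measurable_apply j)

lemma measurable_truncEntry (R : ℝ) (k : Fin m × Fin m × Bool) :
    Measurable (truncEntry z R k) := by
  refine Measurable.const_mul (Measurable.ite (measurableSet_le hz.measurable_dotProduct_self
    measurable_const) ?_ measurable_const) _
  exact (hz.measurable_apply _).mul (hz.measurable_apply _)

lemma integral_truncEntry_sq_le (R : ℝ) (k : Fin m × Fin m × Bool) :
    ∫ e, truncEntry z R k e ^ 2 ∂μ ≤ η := by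
  have h1 : ∫ e, truncEntry z R k e ^ 2 ∂μ ≤ ∫ e, (z e k.1 * z e k.2.1) ^ 2 ∂μ :=
    integral_mono_of_nonneg (Eventually.of_forall fun _ => sq_nonneg _)
      (memLp_two_mul (hz.memLp _) (hz.memLp _)).integrable_sq
      (Eventually.of_forall (truncEntry_sq_le R k))
  have h2 := integral_sq_mul_sq_le (hz.memLp k.1) (hz.memLp k.2.1) one_pos
  have h3 := hz.fourth k.1
  have h4 := hz.fourth k.2.1
  linarith

lemma memLp_dotProduct_self : MemLp (fun e => z e ⬝ᵥ z e) 2 μ :=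
  memLp_finsetSum _ fun j _ => memLp_two_mul (hz.memLp j) (hz.memLp j)

lemma integral_dotProduct_self_sq_le : ∫ e, (z e ⬝ᵥ z e) ^ 2 ∂μ ≤ m ^ 2 * η := by
  have h : ∀ e, (z e ⬝ᵥ z e) ^ 2 ≤ m * ∑ j, z e j ^ 4 := fun e => by
    have := sq_sum_le_card_mul_sum_sq (s := Finset.univ) (f := fun j => z e j ^ 2)
    simpa [dotProduct, ← sq, ← pow_mul] using this
  calc ∫ e, (z e ⬝ᵥ z e) ^ 2 ∂μ ≤ ∫ e, (m : ℝ) * ∑ j, z e j ^ 4 ∂μ :=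
        integral_mono hz.memLp_dotProduct_self.integrable_sq
          ((integrable_finsetSum _ fun j _ => integrable_pow_four (hz.memLp j)).const_mul _) h
    _ = m * ∑ j, ∫ e, z e j ^ 4 ∂μ := by
        rw [integral_const_mul, integral_finsetSum _ fun j _ => integrable_pow_four (hz.memLp j)]
    _ ≤ m * ∑ _j : Fin m, η := by
        gcongr with j
        exact hz.fourth j
    _ = m ^ 2 * η := by simp; ring

lemma memLp_dotProduct (v : Fin m → ℝ) : MemLp (fun e => v ⬝ᵥ z e) 4 μ :=
  memLp_finsetSum _ fun j _ => (hz.memLp j).const_mul (v j)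

lemma integral_dotProduct_pow_four_le (v : Fin m → ℝ) :
    ∫ e, (v ⬝ᵥ z e) ^ 4 ∂μ ≤ (v ⬝ᵥ v) ^ 2 * (m ^ 2 * η) := by
  calc ∫ e, (v ⬝ᵥ z e) ^ 4 ∂μ ≤ ∫ e, (v ⬝ᵥ v) ^ 2 * (z e ⬝ᵥ z e) ^ 2 ∂μ := by
        refine integral_mono (integrable_pow_four (hz.memLp_dotProduct v))
          (hz.memLp_dotProduct_self.integrable_sq.const_mul _) fun e => ?_
        simp only
        rw [← mul_pow, show (v ⬝ᵥ z e) ^ 4 = ((v ⬝ᵥ z e) ^ 2) ^ 2 by ring]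
        gcongr
        exact dotProduct_sq_le _ _
    _ ≤ _ := by
        rw [integral_const_mul]
        gcongr
        exact hz.integral_dotProduct_self_sq_le

variable [IsProbabilityMeasure μ]

lemma integrable_mul (j k : Fin m) : Integrable (fun e => z e j * z e k) μ :=
  (memLp_two_mul (hz.memLp j) (hz.memLp k)).integrable one_le_two

lemma integral_dotProduct_sq (v : Fin m → ℝ) : ∫ e, (v ⬝ᵥ z e) ^ 2 ∂μ = v ⬝ᵥ v := by
  have h : ∀ e, (v ⬝ᵥ z e) ^ 2 = ∑ j, ∑ k, v j * v k * (z e j * z e k) := fun e => by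
    rw [sq, dotProduct, Finset.sum_mul_sum]
    exact Finset.sum_congr rfl fun j _ => Finset.sum_congr rfl fun k _ => by ring
  simp only [h]
  rw [integral_finsetSum _ fun j _ => integrable_finsetSum _ fun k _ =>
    (hz.integrable_mul j k).const_mul _]
  refine Finset.sum_congr rfl fun j _ => ?_
  rw [integral_finsetSum _ fun k _ => (hz.integrable_mul j k).const_mul _]
  simp only [integral_const_mul, hz.second]
  simp

/-- Where `|z|² > R` the truncation loses `(v·z)² ≤ |v|²|z|² ≤ |v|²|z|⁴ / R`. Its mean is at most
`|v|² m²η / R`, and `R = 4m²η` makes this a quarter of `|v|²`. -/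
lemma le_sum_mul_integral_truncEntry (hη : 0 < η) (hm : 0 < m) (v : Fin m → ℝ) :
    3 / 4 * (v ⬝ᵥ v)
      ≤ ∑ j, ∑ k, v j * v k * ∫ e, truncEntry z (4 * m ^ 2 * η) (j, k, true) e ∂μ := by
  set R := 4 * (m : ℝ) ^ 2 * η with hR
  have hm' : (0 : ℝ) < m := by exact_mod_cast hm
  have hR0 : 0 < R := by positivity
  have hint : ∀ j k, Integrable (truncEntry z R (j, k, true)) μ := fun j k =>
    Integrable.of_bound (hz.measurable_truncEntry R _).aestronglyMeasurable R
      (Eventually.of_forall fun e => abs_truncEntry_le hR0.le _ e)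
  have h1 : ∑ j, ∑ k, v j * v k * ∫ e, truncEntry z R (j, k, true) e ∂μ
      = ∫ e, ∑ j, ∑ k, v j * v k * truncEntry z R (j, k, true) e ∂μ := by
    rw [integral_finsetSum _ fun j _ => integrable_finsetSum _ fun k _ =>
      (hint j k).const_mul _]
    refine Finset.sum_congr rfl fun j _ => ?_
    rw [integral_finsetSum _ fun k _ => (hint j k).const_mul _]
    simp only [integral_const_mul]
  have h2 : ∀ e, (v ⬝ᵥ z e) ^ 2 - (v ⬝ᵥ v) / R * (z e ⬝ᵥ z e) ^ 2
      ≤ ∑ j, ∑ k, v j * v k * truncEntry z R (j, k, true) e := fun e => by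
    have hv := dotProduct_self_nonneg' v
    have hz' := dotProduct_self_nonneg' (z e)
    rw [sum_mul_truncEntry]
    split_ifs with h
    · have : 0 ≤ (v ⬝ᵥ v) / R * (z e ⬝ᵥ z e) ^ 2 := by positivity
      linarith
    · have h3 := dotProduct_sq_le v (z e)
      push Not at h
      have h4 : (v ⬝ᵥ v) * (z e ⬝ᵥ z e) ≤ (v ⬝ᵥ v) / R * (z e ⬝ᵥ z e) ^ 2 := by
        rw [div_mul_eq_mul_div, le_div_iff₀ hR0, sq, mul_assoc]
        gcongr
      linarith
  have hi1 : Integrable (fun e => (v ⬝ᵥ z e) ^ 2) μ := by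
    have : MemLp (fun e => v ⬝ᵥ z e) 2 μ := (hz.memLp_dotProduct v).mono_exponent (by norm_num)
    exact this.integrable_sq
  have hi2 : Integrable (fun e => (v ⬝ᵥ v) / R * (z e ⬝ᵥ z e) ^ 2) μ :=
    hz.memLp_dotProduct_self.integrable_sq.const_mul _
  have h3 := integral_mono (hi1.sub hi2) (integrable_finsetSum _ fun j _ =>
    integrable_finsetSum _ fun k _ => (hint j k).const_mul _) h2
  rw [h1]
  refine le_trans ?_ h3
  simp only [Pi.sub_apply]
  rw [integral_sub hi1 hi2, hz.integral_dotProduct_sq, integral_const_mul]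
  have h4 := hz.integral_dotProduct_self_sq_le
  have hv := dotProduct_self_nonneg' v
  have h5 : (v ⬝ᵥ v) / R * ∫ e, (z e ⬝ᵥ z e) ^ 2 ∂μ ≤ (v ⬝ᵥ v) / R * (m ^ 2 * η) := by gcongr
  have h6 : (v ⬝ᵥ v) / R * (m ^ 2 * η) = (v ⬝ᵥ v) / 4 := by rw [hR]; field_simp
  linarith

end Isotropic

/-- The event that the second moment matrix of the truncated vectors `z (e l)`, `l < n`, `l ≠ i`,
deviates from its mean in one of the entries. -/
def deviationSet (μ : Measure E) (z : E → Fin m → ℝ) (η : ℝ) (n i : ℕ) : Set (ℕ → E) :=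
  {e | ∃ k : Fin m × Fin m × Bool, (n : ℝ) / (8 * m) ≤
    ∑ l ∈ (Finset.range n).erase i, (truncEntry z (4 * m ^ 2 * η) k (e l)
      - ∫ e', truncEntry z (4 * m ^ 2 * η) k e' ∂μ)}

lemma Isotropic.dotProduct_self_le_of_notMem_deviationSet [IsProbabilityMeasure μ]
    (hz : Isotropic μ z η) (hη : 0 < η) (hm : 0 < m) {n i : ℕ} (hn : 6 ≤ n) (hi : i < n) {e : ℕ → E}
    (he : e ∉ deviationSet μ z η n i) (v : Fin m → ℝ) :
    v ⬝ᵥ v ≤ 2 * ((n : ℝ)⁻¹ * ∑ l ∈ Finset.range n, (v ⬝ᵥ z (e l)) ^ 2) := by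
  set R := 4 * (m : ℝ) ^ 2 * η
  set t := (Finset.range n).erase i with ht
  have hm' : (0 : ℝ) < m := by exact_mod_cast hm
  have hn' : (6 : ℝ) ≤ n := by exact_mod_cast hn
  have hcard : (t.card : ℝ) = n - 1 := by
    rw [ht, Finset.card_erase_of_mem (by simpa using hi), Finset.card_range,
      Nat.cast_sub (by omega)]
    simp
  have hdev : ∀ k : Fin m × Fin m × Bool,
      ∑ l ∈ t, (truncEntry z R k (e l) - ∫ e', truncEntry z R k e' ∂μ) ≤ n / (8 * m) := by
    intro k
    by_contra hcon
    push Not at hcon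
    exact he ⟨k, hcon.le⟩
  set d : Fin m → Fin m → ℝ := fun j k =>
    ∑ l ∈ t, (truncEntry z R (j, k, true) (e l) - ∫ e', truncEntry z R (j, k, true) e' ∂μ) with hd
  have habs : ∀ j k, |d j k| ≤ n / (8 * m) := by
    intro j k
    refine abs_le'.2 ⟨hdev (j, k, true), ?_⟩
    have := hdev (j, k, false)
    simp only [truncEntry_false, integral_neg] at this
    refine le_trans (le_of_eq ?_) this
    rw [hd]
    simp only
    rw [← Finset.sum_neg_distrib]
    exact Finset.sum_congr rfl fun l _ => by ring
  -- Truncating and dropping observation `i` only remove nonnegative terms, so both are free for a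
  -- lower bound.
  have h1 : ∑ l ∈ t, ∑ j, ∑ k, v j * v k * truncEntry z R (j, k, true) (e l)
      ≤ ∑ l ∈ Finset.range n, (v ⬝ᵥ z (e l)) ^ 2 := by
    refine (Finset.sum_le_sum fun l _ => ?_).trans (Finset.sum_le_sum_of_subset_of_nonneg
      (Finset.erase_subset i (Finset.range n)) fun l _ _ => sq_nonneg (v ⬝ᵥ z (e l)))
    rw [sum_mul_truncEntry]
    split_ifs
    · rfl
    · positivity
  have h2 : ∑ l ∈ t, ∑ j, ∑ k, v j * v k * truncEntry z R (j, k, true) (e l)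
      = ∑ j, ∑ k, v j * v k * d j k
        + (n - 1) * ∑ j, ∑ k, v j * v k * ∫ e', truncEntry z R (j, k, true) e' ∂μ := by
    rw [Finset.sum_comm, Finset.mul_sum, ← Finset.sum_add_distrib]
    refine Finset.sum_congr rfl fun j _ => ?_
    rw [Finset.sum_comm, Finset.mul_sum, ← Finset.sum_add_distrib]
    refine Finset.sum_congr rfl fun k _ => ?_
    rw [hd]
    simp only [Finset.sum_sub_distrib, Finset.sum_const, nsmul_eq_mul, hcard]
    rw [← Finset.mul_sum]
    ring
  -- The entrywise tolerance `n / (8m)` is chosen for this: summing over all entries costs `(∑ |v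
  -- j|)² ≤ m |v|²`.
  have h3 : -(n / 8 * (v ⬝ᵥ v)) ≤ ∑ j, ∑ k, v j * v k * d j k := by
    rw [neg_le]
    calc -∑ j, ∑ k, v j * v k * d j k = ∑ j, ∑ k, -(v j * v k * d j k) := by
          simp only [Finset.sum_neg_distrib]
      _ ≤ ∑ j, ∑ k, |v j| * |v k| * (n / (8 * m)) := by
          refine Finset.sum_le_sum fun j _ => Finset.sum_le_sum fun k _ => ?_
          refine (neg_le_abs _).trans ?_
          rw [abs_mul, abs_mul]
          gcongr
          exact habs j k
      _ = (∑ j, |v j|) ^ 2 * (n / (8 * m)) := by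
          rw [sq, Finset.sum_mul_sum, Finset.sum_mul]
          exact Finset.sum_congr rfl fun j _ => by rw [Finset.sum_mul]
      _ ≤ m * (v ⬝ᵥ v) * (n / (8 * m)) := by
          gcongr
          exact sum_abs_sq_le v
      _ = n / 8 * (v ⬝ᵥ v) := by field_simp
  have h4 := hz.le_sum_mul_integral_truncEntry hη hm v
  have hv := dotProduct_self_nonneg' v
  -- `3/4 · (n - 1) - n/8 ≥ n/2` holds exactly when `n ≥ 6`.
  have h5 : (n : ℝ) / 2 * (v ⬝ᵥ v) ≤ ∑ l ∈ Finset.range n, (v ⬝ᵥ z (e l)) ^ 2 := by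
    refine le_trans ?_ h1
    rw [h2]
    have h6 : ((n : ℝ) - 1) * (3 / 4 * (v ⬝ᵥ v)) ≤ (n - 1) *
        ∑ j, ∑ k, v j * v k * ∫ e', truncEntry z R (j, k, true) e' ∂μ := by
      refine mul_le_mul_of_nonneg_left h4 (by linarith)
    nlinarith
  calc v ⬝ᵥ v = 2 * ((n : ℝ)⁻¹ * ((n : ℝ) / 2 * (v ⬝ᵥ v))) := by field_simp
    _ ≤ _ := by gcongr

/-- The bound for the probability of a `deviationSet`. -/
noncomputable def deviationBound (η : ℝ) (n m : ℕ) : ℝ :=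
  2 * m ^ 2 * Real.exp (-(n / (256 * η * m ^ 3)))

lemma Isotropic.lintegral_mul_indicator_deviationSet_le [IsProbabilityMeasure P]
    [IsProbabilityMeasure μ]
    (hz : Isotropic μ z η) (hη : 0 < η) (hm : 0 < m)
    (hD : ∀ i, Measurable (D i)) (hind : iIndepFun D P) (hlaw : ∀ i, P.map (D i) = μ)
    {f : E → ℝ≥0∞} (hf : Measurable f) (n i : ℕ) :
    ∫⁻ x, f (D i x) * (deviationSet μ z η n i).indicator 1 (fun l => D l x) ∂P
      ≤ (∫⁻ e, f e ∂μ) * ENNReal.ofReal (deviationBound η n m) := by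
  have hm' : (1 : ℝ) ≤ m := by exact_mod_cast hm
  have hR : 0 ≤ 4 * (m : ℝ) ^ 2 * η := by positivity
  -- For this Chernoff parameter `l`, `l R = 1/4`, the quadratic term is at most `n / (256 η m⁴)`,
  -- and the linear gain is `n / (128 η m³)`; as `m ≥ 1`, half of the gain survives.
  have hl : 0 ≤ 1 / (16 * η * (m : ℝ) ^ 2) := by positivity
  have h := lintegral_comp_mul_indicator_exists_le hD hind hlaw
    (w := truncEntry z (4 * m ^ 2 * η)) (hz.measurable_truncEntry _)
    (fun k e => abs_truncEntry_le hR k e) (hz.integral_truncEntry_sq_le _) hl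
    (by field_simp; norm_num) hf (t := (Finset.range n).erase i) (i := i) (by simp)
    ((n : ℝ) / (8 * m))
  refine (le_of_eq ?_).trans (h.trans ?_)
  · rfl
  · gcongr
    rw [deviationBound]
    have hc : (Fintype.card (Fin m × Fin m × Bool) : ℝ) = 2 * m ^ 2 := by
      simp; ring
    rw [hc]
    gcongr
    have hcard : (((Finset.range n).erase i).card : ℝ) ≤ n := by
      exact_mod_cast (Finset.card_erase_le).trans (Finset.card_range n).le
    calc (((Finset.range n).erase i).card : ℝ) * ((1 / (16 * η * (m : ℝ) ^ 2)) ^ 2 * η)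
          - 1 / (16 * η * (m : ℝ) ^ 2) * (n / (8 * m))
        ≤ n * ((1 / (16 * η * (m : ℝ) ^ 2)) ^ 2 * η)
          - 1 / (16 * η * (m : ℝ) ^ 2) * (n / (8 * m)) := by gcongr
      _ = n / (256 * η * (m : ℝ) ^ 3) * (1 / m) - 2 * (n / (256 * η * (m : ℝ) ^ 3)) := by
          field_simp; ring
      _ ≤ n / (256 * η * (m : ℝ) ^ 3) * 1 - 2 * (n / (256 * η * (m : ℝ) ^ 3)) := by
          gcongr
          rw [div_le_one (by positivity)]; exact hm'
      _ = _ := by ring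

/-- The summands are independent and centred in each coordinate, so each coordinate contributes a
variance of order `1/n`; there are `m` coordinates. -/
lemma Isotropic.lintegral_score_le [IsProbabilityMeasure P]
    (hz : Isotropic μ z η) (hD : ∀ i, Measurable (D i)) (hind : iIndepFun D P)
    (hlaw : ∀ i, P.map (D i) = μ) {u : E → ℝ} (hu : Measurable u) (hu4 : MemLp u 4 μ)
    (huz : ∀ j, ∫ e, u e * z e j ∂μ = 0) {K c : ℝ} (hK : ∫ e, u e ^ 4 ∂μ ≤ K) (hc : 0 < c)
    (n : ℕ) :
    ∫⁻ x, ENNReal.ofReal (((n : ℝ)⁻¹ • ∑ i ∈ Finset.range n, u (D i x) • z (D i x)) ⬝ᵥ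
        ((n : ℝ)⁻¹ • ∑ i ∈ Finset.range n, u (D i x) • z (D i x))) ∂P
      ≤ ENNReal.ofReal ((n : ℝ)⁻¹ * (m * ((K / c + c * η) / 2))) := by
  have hq : ∀ j, Measurable fun e => u e * z e j := fun j => hu.mul (hz.measurable_apply j)
  have h1 : ∀ x, ENNReal.ofReal (((n : ℝ)⁻¹ • ∑ i ∈ Finset.range n, u (D i x) • z (D i x)) ⬝ᵥ
        ((n : ℝ)⁻¹ • ∑ i ∈ Finset.range n, u (D i x) • z (D i x)))
      = ∑ j, ENNReal.ofReal
        (((n : ℝ)⁻¹ * ∑ i ∈ Finset.range n, u (D i x) * z (D i x) j) ^ 2) := fun x => by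
    rw [← ENNReal.ofReal_sum_of_nonneg fun _ _ => sq_nonneg _]
    simp [dotProduct, sq]
  simp only [h1]
  rw [lintegral_finsetSum _ fun j _ => by
    have : ∀ i, Measurable fun x => u (D i x) * z (D i x) j := fun i => (hq j).comp (hD i)
    fun_prop]
  calc _ = ∑ j, ENNReal.ofReal ((n : ℝ)⁻¹ * ∫ e, (u e * z e j) ^ 2 ∂μ) :=
        Finset.sum_congr rfl fun j _ => lintegral_sq_average_eq hD hind hlaw (hq j)
          (memLp_two_mul hu4 (hz.memLp j)) (huz j) n
    _ = ENNReal.ofReal ((n : ℝ)⁻¹ * ∑ j, ∫ e, (u e * z e j) ^ 2 ∂μ) := by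
        rw [Finset.mul_sum, ENNReal.ofReal_sum_of_nonneg]
        intro j _
        have : 0 ≤ ∫ e, (u e * z e j) ^ 2 ∂μ := integral_nonneg fun _ => sq_nonneg _
        positivity
    _ ≤ _ := by
        refine ENNReal.ofReal_le_ofReal ?_
        gcongr
        calc ∑ j, ∫ e, (u e * z e j) ^ 2 ∂μ ≤ ∑ _j : Fin m, (K / c + c * η) / 2 := by
              refine Finset.sum_le_sum fun j _ => ?_
              refine (integral_sq_mul_sq_le hu4 (hz.memLp j) hc).trans ?_
              have := hz.fourth j
              gcongr
          _ = _ := by simp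

end Isotropic

/-! ### Moments of the regressor and of the Galerkin residual. -/

section Moments

open Matrix

variable {Ω : Type*} [MeasurableSpace Ω] {P : Measure Ω}
  {H : Type*} [NormedAddCommGroup H] [InnerProductSpace ℝ H]

/-- A countable basis gives separability, which makes Borel maps into the space strongly measurable.
-/
lemma secondCountableTopology_of_hilbertBasis (ψ : HilbertBasis ℕ ℝ H) :
    SecondCountableTopology H := by
  have h : TopologicalSpace.IsSeparable (Set.univ : Set H) := by
    have h1 : TopologicalSpace.IsSeparable (Submodule.span ℝ (Set.range ψ) : Set H) :=
      (Set.countable_range ψ).isSeparable.span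
    have h2 := h1.closure
    rw [← Submodule.topologicalClosure_coe, ψ.dense_span] at h2
    simpa using h2
  have := TopologicalSpace.isSeparable_univ_iff.1 h
  exact UniformSpace.secondCountable_of_separable H

lemma mulVec_coeffs_apply (ψ : HilbertBasis ℕ ℝ H) {m : ℕ} (S : Matrix (Fin m) (Fin m) ℝ)
    (j : Fin m) (x : H) : (S *ᵥ coeffs ψ m x) j = inner ℝ (synth ψ m (S j)) x := by
  rw [inner_synth]; rfl

variable [MeasurableSpace H] [BorelSpace H] {ψ : HilbertBasis ℕ ℝ H} {X : Ω → H} {η : ℝ}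

lemma measurable_inner_const (f : H) : Measurable fun x : H => inner ℝ f x :=
  (by fun_prop : Continuous fun x : H => inner ℝ f x).measurable

lemma measurable_coeffs (ψ : HilbertBasis ℕ ℝ H) (m : ℕ) : Measurable (coeffs ψ m) := by
  refine measurable_pi_lambda _ fun j => ?_
  simpa only [coeffs, real_inner_comm] using measurable_inner_const (ψ j)

lemma aemeasurable_inner_right (f : H) (hX : AEMeasurable X P) :
    AEMeasurable (fun w => inner ℝ f (X w)) P :=
  (measurable_inner_const f).comp_aemeasurable hX

variable [CompleteSpace H]

namespace MemX

variable (hX : MemX P X)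
include hX

lemma memLp_inner (f : H) : MemLp (fun w => inner ℝ f (X w)) 2 P :=
  hX.memLp.const_inner f

lemma integral_inner_mul_inner [SecondCountableTopology H] (f g : H) :
    ∫ w, inner ℝ f (X w) * inner ℝ g (X w) ∂P = inner ℝ (covOp P X f) g := by
  have h : MemLp id 2 (P.map X) := by
    rw [memLp_map_measure_iff aestronglyMeasurable_id hX.aemeasurable]
    exact hX.memLp
  rw [covOp, covarianceOperator_inner h, integral_map hX.aemeasurable]
  exact (by fun_prop : Continuous fun x : H => inner ℝ f x * inner ℝ g x).aestronglyMeasurable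

lemma inner_covOp_comm [SecondCountableTopology H] (f g : H) :
    inner ℝ (covOp P X f) g = inner ℝ (covOp P X g) f := by
  rw [← hX.integral_inner_mul_inner, ← hX.integral_inner_mul_inner]
  simp only [mul_comm]

lemma posDef_truncMatrix [SecondCountableTopology H] (ψ : HilbertBasis ℕ ℝ H) (m : ℕ) :
    (truncMatrix ψ m (covOp P X)).PosDef := by
  refine Matrix.PosDef.of_dotProduct_mulVec_pos ?_ fun v hv => ?_
  · ext i j
    simp only [conjTranspose_apply, truncMatrix, of_apply, star_trivial]
    exact hX.inner_covOp_comm _ _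
  · rw [star_trivial, truncMatrix_mulVec, ← inner_synth, real_inner_comm]
    refine hX.pos _ fun h => hv ?_
    rw [← coeffs_synth ψ m v, h]
    ext; simp [coeffs]

lemma sum_inner_covOp_le [SecondCountableTopology H] (ψ : HilbertBasis ℕ ℝ H) (s : Finset ℕ) :
    ∑ j ∈ s, inner ℝ (covOp P X (ψ j)) (ψ j) ≤ ∫ w, ‖X w‖ ^ 2 ∂P := by
  simp only [← hX.integral_inner_mul_inner, ← sq]
  rw [← integral_finsetSum _ fun j _ => (hX.memLp_inner (ψ j)).integrable_sq]
  refine integral_mono (integrable_finsetSum _ fun j _ => (hX.memLp_inner (ψ j)).integrable_sq)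
    (hX.memLp.integrable_norm_pow two_ne_zero) fun w => ?_
  simpa using ψ.orthonormal.sum_inner_products_le (X w) (s := s)

end MemX

namespace MemXMoment

variable (hη : 0 ≤ η) (hX : MemXMoment P ψ 4 η X)
include hη hX

lemma memLp_coeff [SecondCountableTopology H] (j : ℕ) :
    MemLp (fun w => inner ℝ (ψ j) (X w)) 4 P ∧
    ∫ w, inner ℝ (ψ j) (X w) ^ 4 ∂P ≤ η * inner ℝ (covOp P X (ψ j)) (ψ j) ^ 2 := by
  set g := inner ℝ (covOp P X (ψ j)) (ψ j)
  have hg : 0 < g := hX.pos _ (ψ.orthonormal.ne_zero j)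
  have hs := Real.sqrt_pos.2 hg
  have hs4 : Real.sqrt g ^ 4 = g ^ 2 := by
    rw [show Real.sqrt g ^ 4 = (Real.sqrt g ^ 2) ^ 2 by ring, Real.sq_sqrt hg.le]
  have hm := aemeasurable_inner_right (ψ j) hX.aemeasurable
  have h := hX.moment_coeff j
  have hc : ∀ w, inner ℝ (X w) (ψ j) = inner ℝ (ψ j) (X w) := fun w => real_inner_comm _ _
  simp only [hc] at h
  obtain ⟨h1, h2⟩ := memLp_four_of_lintegral_le (hm.div_const _).aestronglyMeasurable hη h
  have h3 : ∀ w, Real.sqrt g * (inner ℝ (ψ j) (X w) / Real.sqrt g) = inner ℝ (ψ j) (X w) :=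
    fun w => by field_simp
  have h4 : MemLp (fun w => Real.sqrt g * (inner ℝ (ψ j) (X w) / Real.sqrt g)) 4 P :=
    h1.const_mul (Real.sqrt g)
  refine ⟨by simpa only [h3] using h4, ?_⟩
  simp only [div_pow, integral_div] at h2
  rw [hs4] at h2
  rwa [div_le_iff₀ (by positivity)] at h2

/-- Jensen's inequality for the standardised coordinates with weights `|⟨h, ψ j⟩| √(g j)`. By
Cauchy–Schwarz and the trace bound, the squared total weight is at most `‖h‖² E‖X‖²`, uniformly in
`s`. -/
lemma integral_sum_pow_four_le [SecondCountableTopology H] (h : H) (s : Finset ℕ) :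
    ∫ w, (∑ j ∈ s, inner ℝ h (ψ j) * inner ℝ (ψ j) (X w)) ^ 4 ∂P
      ≤ η * (‖h‖ ^ 4 * (∫ w, ‖X w‖ ^ 2 ∂P) ^ 2) := by
  set g : ℕ → ℝ := fun j => inner ℝ (covOp P X (ψ j)) (ψ j) with hg
  have hg0 : ∀ j, 0 < g j := fun j => hX.pos _ (ψ.orthonormal.ne_zero j)
  have hs : ∀ j, 0 < Real.sqrt (g j) := fun j => Real.sqrt_pos.2 (hg0 j)
  have hs4 : ∀ j, Real.sqrt (g j) ^ 4 = g j ^ 2 := fun j => by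
    rw [show Real.sqrt (g j) ^ 4 = (Real.sqrt (g j) ^ 2) ^ 2 by ring, Real.sq_sqrt (hg0 j).le]
  set a : ℕ → ℝ := fun j => |inner ℝ h (ψ j)| * Real.sqrt (g j) with ha
  have ha0 : ∀ j, 0 ≤ a j := fun j => by positivity
  have hi : ∀ j, Integrable (fun w => (inner ℝ (ψ j) (X w) / Real.sqrt (g j)) ^ 4) P := fun j =>
    integrable_pow_four (by
      simpa only [div_eq_mul_inv] using (memLp_coeff hη hX j).1.mul_const (Real.sqrt (g j))⁻¹)
  have hb : ∀ j, ∫ w, (inner ℝ (ψ j) (X w) / Real.sqrt (g j)) ^ 4 ∂P ≤ η := fun j => by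
    simp only [div_pow, integral_div, hs4]
    rw [div_le_iff₀ (pow_pos (hg0 j) 2)]
    exact (memLp_coeff hη hX j).2
  have hpt : ∀ w, (∑ j ∈ s, inner ℝ h (ψ j) * inner ℝ (ψ j) (X w)) ^ 4
      ≤ (∑ j ∈ s, a j) ^ 3 * ∑ j ∈ s, a j * (inner ℝ (ψ j) (X w) / Real.sqrt (g j)) ^ 4 := by
    intro w
    have h1 := sum_mul_pow_four_le s ha0 fun j => |inner ℝ (ψ j) (X w) / Real.sqrt (g j)|
    simp only [(by decide : Even 4).pow_abs] at h1
    refine le_trans ?_ h1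
    rw [← (by decide : Even 4).pow_abs]
    gcongr
    refine (Finset.abs_sum_le_sum_abs _ _).trans (Finset.sum_le_sum fun j _ => le_of_eq ?_)
    have := hs j
    rw [ha, abs_mul, abs_div, abs_of_pos this]
    field_simp
  have hA : 0 ≤ ∑ j ∈ s, a j := Finset.sum_nonneg fun j _ => ha0 j
  have hA2 : (∑ j ∈ s, a j) ^ 2 ≤ ‖h‖ ^ 2 * ∫ w, ‖X w‖ ^ 2 ∂P := by
    have h1 := Finset.sum_mul_sq_le_sq_mul_sq s (fun j => |inner ℝ h (ψ j)|)
      fun j => Real.sqrt (g j)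
    refine h1.trans ?_
    have h2 : ∑ j ∈ s, |inner ℝ h (ψ j)| ^ 2 ≤ ‖h‖ ^ 2 := by
      simpa [real_inner_comm h] using ψ.orthonormal.sum_inner_products_le h (s := s)
    have h3 : ∑ j ∈ s, Real.sqrt (g j) ^ 2 ≤ ∫ w, ‖X w‖ ^ 2 ∂P := by
      simp only [Real.sq_sqrt (hg0 _).le]
      exact hX.sum_inner_covOp_le ψ s
    gcongr
  calc _ ≤ ∫ w, (∑ j ∈ s, a j) ^ 3 *
          ∑ j ∈ s, a j * (inner ℝ (ψ j) (X w) / Real.sqrt (g j)) ^ 4 ∂P := by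
        refine integral_mono_of_nonneg (Eventually.of_forall fun w => ?_) ?_
          (Eventually.of_forall hpt)
        · simp only [Pi.zero_apply]; positivity
        · exact (integrable_finsetSum _ fun j _ => (hi j).const_mul _).const_mul _
    _ = (∑ j ∈ s, a j) ^ 3 *
          ∑ j ∈ s, a j * ∫ w, (inner ℝ (ψ j) (X w) / Real.sqrt (g j)) ^ 4 ∂P := by
        rw [integral_const_mul, integral_finsetSum _ fun j _ => (hi j).const_mul _]
        simp only [integral_const_mul]
    _ ≤ (∑ j ∈ s, a j) ^ 3 * ∑ j ∈ s, a j * η := by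
        gcongr with j
        exact hb j
    _ = η * ((∑ j ∈ s, a j) ^ 2) ^ 2 := by rw [← Finset.sum_mul]; ring
    _ ≤ η * (‖h‖ ^ 2 * ∫ w, ‖X w‖ ^ 2 ∂P) ^ 2 := by gcongr
    _ = _ := by ring

/-- Fatou's lemma passes the uniform bound on partial sums to the full series. -/
lemma memLp_inner_four [SecondCountableTopology H] (h : H) :
    MemLp (fun w => inner ℝ h (X w)) 4 P ∧
    ∫ w, inner ℝ h (X w) ^ 4 ∂P ≤ η * (‖h‖ ^ 4 * (∫ w, ‖X w‖ ^ 2 ∂P) ^ 2) := by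
  refine memLp_four_of_lintegral_le
    (aemeasurable_inner_right h hX.aemeasurable).aestronglyMeasurable (by positivity) ?_
  set F : ℕ → Ω → ℝ := fun k w =>
    ∑ j ∈ Finset.range k, inner ℝ h (ψ j) * inner ℝ (ψ j) (X w) with hF
  have hlim : ∀ w, Tendsto (fun k => ENNReal.ofReal (F k w ^ 4)) atTop
      (𝓝 (ENNReal.ofReal (|inner ℝ h (X w)| ^ 4))) := fun w => by
    rw [(by decide : Even 4).pow_abs]
    exact ENNReal.tendsto_ofReal (((ψ.hasSum_inner_mul_inner h (X w)).tendsto_sum_nat).pow 4)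
  have hmem : ∀ k, MemLp (F k) 4 P := fun k =>
    memLp_finsetSum _ fun j _ => (memLp_coeff hη hX j).1.const_mul _
  have hmeas : ∀ k, AEMeasurable (fun w => ENNReal.ofReal (F k w ^ 4)) P := fun k =>
    ((hmem k).aestronglyMeasurable.aemeasurable.pow_const 4).ennreal_ofReal
  calc ∫⁻ w, ENNReal.ofReal (|inner ℝ h (X w)| ^ 4) ∂P
      = ∫⁻ w, liminf (fun k => ENNReal.ofReal (F k w ^ 4)) atTop ∂P :=
        lintegral_congr fun w => (hlim w).liminf_eq.symm
    _ ≤ liminf (fun k => ∫⁻ w, ENNReal.ofReal (F k w ^ 4) ∂P) atTop :=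
        lintegral_liminf_le' hmeas
    _ ≤ liminf (fun _ : ℕ => ENNReal.ofReal (η * (‖h‖ ^ 4 * (∫ w, ‖X w‖ ^ 2 ∂P) ^ 2)))
          atTop := by
        refine liminf_le_liminf (Eventually.of_forall fun k => ?_)
        rw [← ofReal_integral_eq_lintegral_ofReal (integrable_pow_four (hmem k))
          (Eventually.of_forall fun w => by simp only [Pi.zero_apply]; positivity)]
        exact ENNReal.ofReal_le_ofReal (integral_sum_pow_four_le hη hX h _)
    _ = _ := liminf_const _

end MemXMoment

/-- The standardised coefficient vector `[Γ]_m^{-1/2} [x]_m`, as a function of the pair `(y, x)`. -/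
noncomputable def standardize (P : Measure Ω) (ψ : HilbertBasis ℕ ℝ H) (m : ℕ) (X : Ω → H)
    (e : ℝ × H) : Fin m → ℝ :=
  invSqrt (truncMatrix ψ m (covOp P X)) *ᵥ coeffs ψ m e.2

lemma MemXMoment.isotropic_standardize [SecondCountableTopology H] (hη : 0 ≤ η)
    (hX : MemXMoment P ψ 4 η X) {Y : Ω → ℝ} (hY : AEMeasurable Y P) (m : ℕ) :
    Isotropic (P.map fun w => (Y w, X w)) (standardize P ψ m X) η := by
  set G := truncMatrix ψ m (covOp P X) with hGdef
  have hG : G.PosDef := hX.posDef_truncMatrix ψ m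
  have hYX : AEMeasurable (fun w => (Y w, X w)) P := hY.prodMk hX.aemeasurable
  have happ : ∀ (j : Fin m) (e : ℝ × H),
      standardize P ψ m X e j = inner ℝ (synth ψ m (invSqrt G j)) e.2 := fun j e =>
    mulVec_coeffs_apply ψ _ j e.2
  have hmj : ∀ j, Measurable fun e : ℝ × H => standardize P ψ m X e j := fun j => by
    simp only [happ]
    exact (measurable_inner_const _).comp measurable_snd
  have hb : ∀ j, MemLp (fun w => standardize P ψ m X (Y w, X w) j) 4 P ∧
      ∫ w, standardize P ψ m X (Y w, X w) j ^ 4 ∂P ≤ η := fun j =>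
    memLp_four_of_lintegral_le ((hmj j).comp_aemeasurable hYX).aestronglyMeasurable hη
      (hX.moment_std m j)
  refine ⟨measurable_pi_lambda _ hmj, fun j => ?_, fun j => ?_, fun j k => ?_⟩
  · rw [memLp_map_measure_iff (hmj j).aestronglyMeasurable hYX]
    exact (hb j).1
  · rw [integral_map hYX ((hmj j).pow_const 4).aestronglyMeasurable]
    exact (hb j).2
  · have hmm : Measurable fun e => standardize P ψ m X e j * standardize P ψ m X e k :=
      (hmj j).mul (hmj k)
    rw [integral_map hYX hmm.aestronglyMeasurable]
    simp only [happ]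
    rw [hX.integral_inner_mul_inner, real_inner_comm, inner_synth, ← truncMatrix_mulVec, ← hGdef]
    have h := congrFun (congrFun (invSqrt_mul_mul_invSqrt hG) k) j
    rw [Matrix.one_apply] at h
    have h2 : invSqrt G k ⬝ᵥ G *ᵥ invSqrt G j = (invSqrt G * G * invSqrt G) k j := by
      have h3 : ∀ i, invSqrt G j i = invSqrt G i j := fun i =>
        congrFun (congrFun (transpose_invSqrt G) i) j
      rw [Matrix.mul_assoc]
      simp only [Matrix.mul_apply, dotProduct, mulVec, h3]
    rw [h2, h]
    simp only [eq_comm]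

variable {β : H} {σ : ℝ} {ε Y : Ω → ℝ}

lemma add_pow_four_le (a b : ℝ) : (a + b) ^ 4 ≤ 8 * (a ^ 4 + b ^ 4) := by
  nlinarith [sq_nonneg (a - b), sq_nonneg (a ^ 2 - b ^ 2), sq_nonneg (a + b),
    mul_nonneg (sq_nonneg (a - b)) (sq_nonneg (a + b)), sq_nonneg ((a - b) ^ 2),
    mul_nonneg (sq_nonneg (a - b)) (sq_nonneg a), mul_nonneg (sq_nonneg (a - b)) (sq_nonneg b)]

lemma integral_add_pow_four_le {f g : Ω → ℝ} (hf : MemLp f 4 P) (hg : MemLp g 4 P) :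
    ∫ w, (f w + g w) ^ 4 ∂P ≤ 8 * (∫ w, f w ^ 4 ∂P + ∫ w, g w ^ 4 ∂P) := by
  rw [← integral_add (integrable_pow_four hf) (integrable_pow_four hg), ← integral_const_mul]
  exact integral_mono (integrable_pow_four (hf.add hg))
    (((integrable_pow_four hf).add (integrable_pow_four hg)).const_mul 8)
    fun w => add_pow_four_le _ _

variable [SecondCountableTopology H]

lemma LinearModel.memLp_four (hη : 0 ≤ η) (hX : MemXMoment P ψ 4 η X) (hε : MemE P 4 η ε)
    (hY : LinearModel P β σ X ε Y) : MemLp Y 4 P := by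
  have h1 := (hX.memLp_inner_four hη β).1
  have h2 := (memLp_four_of_lintegral_le hε.aemeasurable.aestronglyMeasurable hη hε.moment).1
  refine (h1.add (h2.const_mul σ)).ae_eq ?_
  filter_upwards [hY.eq] with w hw
  simp [hw]

lemma LinearModel.integral_mul_inner (hX : MemX P X) (hε : MemE P 4 η ε)
    (hY : LinearModel P β σ X ε Y) (f : H) :
    ∫ w, Y w * inner ℝ f (X w) ∂P = inner ℝ (covOp P X β) f := by
  have hi : Integrable (fun w => ε w • X w) P := by
    have := hX.memLp.smul (p := 2) (q := 2) (r := 1) hε.memLp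
    exact memLp_one_iff_integrable.1 this
  have h0 : ∫ w, inner ℝ f (ε w • X w) ∂P = 0 := by
    rw [integral_inner hi, hY.uncorrelated, inner_zero_right]
  have h1 : Integrable (fun w => inner ℝ β (X w) * inner ℝ f (X w)) P :=
    (hX.memLp_inner β).integrable_mul (hX.memLp_inner f)
  rw [← hX.integral_inner_mul_inner β f]
  calc ∫ w, Y w * inner ℝ f (X w) ∂P
      = ∫ w, (inner ℝ β (X w) * inner ℝ f (X w) + σ * inner ℝ f (ε w • X w)) ∂P := by
        refine integral_congr_ae ?_
        filter_upwards [hY.eq] with w hw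
        rw [hw, inner_smul_right]
        ring
    _ = _ := by
        rw [integral_add h1 ((hi.const_inner f).const_mul σ), integral_const_mul, h0]
        simp

section Galerkin

variable (hη : 0 ≤ η) (hX : MemXMoment P ψ 4 η X) (hε : MemE P 4 η ε)
  (hY : LinearModel P β σ X ε Y)
include hη hX hε hY

/-- For use when `h` stays close to `β` in `L²`: the bound is then free of the dimension. -/
lemma LinearModel.integral_residual_pow_four_le_norm (h : H) :
    ∫ w, (Y w - inner ℝ h (X w)) ^ 4 ∂P
      ≤ 8 * (∫ w, (Y w - inner ℝ β (X w)) ^ 4 ∂P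
        + η * (‖h - β‖ ^ 4 * (∫ w, ‖X w‖ ^ 2 ∂P) ^ 2)) := by
  have hY4 := hY.memLp_four hη hX hε
  obtain ⟨h1, h2⟩ := hX.memLp_inner_four hη (β - h)
  have h3 : MemLp (fun w => Y w - inner ℝ β (X w)) 4 P := hY4.sub (hX.memLp_inner_four hη β).1
  have h5 := integral_add_pow_four_le h3 h1
  simp only [inner_sub_left, sub_add_sub_cancel] at h5 h2
  refine h5.trans ?_
  rw [norm_sub_rev]
  gcongr

variable [IsProbabilityMeasure P] (m : ℕ)

/-- These are the normal equations: `Γh` and `Γβ` have the same first `m` coefficients, and the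
error is uncorrelated with `X`. -/
lemma LinearModel.integral_residual_mul_inner (v : Fin m → ℝ) :
    ∫ w, (Y w - inner ℝ (synth ψ m (galerkinCoeffs ψ m (covOp P X) β)) (X w)) *
      inner ℝ (synth ψ m v) (X w) ∂P = 0 := by
  set h := synth ψ m (galerkinCoeffs ψ m (covOp P X) β) with hh
  have hG := hX.posDef_truncMatrix ψ m
  have hY2 : MemLp Y 2 P := (hY.memLp_four hη hX hε).mono_exponent (by norm_num)
  have h1 : Integrable (fun w => Y w * inner ℝ (synth ψ m v) (X w)) P :=
    hY2.integrable_mul (hX.memLp_inner _)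
  have h2 : Integrable (fun w => inner ℝ h (X w) * inner ℝ (synth ψ m v) (X w)) P :=
    (hX.memLp_inner _).integrable_mul (hX.memLp_inner _)
  simp only [sub_mul]
  rw [integral_sub h1 h2, hX.integral_inner_mul_inner, hY.integral_mul_inner hX.toMemX hε,
    real_inner_comm, inner_synth, real_inner_comm, inner_synth, hh, ← truncMatrix_mulVec,
    truncMatrix_mulVec_galerkinCoeffs ψ hG.det_pos.ne'.isUnit, sub_self]

/-- For use without control of `h - β` in `L²`. In standardised coordinates `⟨h, X⟩ = a·z`, where
`|a|² ≤ E Y²` by Pythagoras, and `E (a·z)⁴ ≤ |a|⁴ E|z|⁴` costs the factor `m²`. -/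
lemma LinearModel.integral_residual_pow_four_le :
    ∫ w, (Y w - inner ℝ (synth ψ m (galerkinCoeffs ψ m (covOp P X) β)) (X w)) ^ 4 ∂P
      ≤ 8 * (∫ w, Y w ^ 4 ∂P + (∫ w, Y w ^ 2 ∂P) ^ 2 * (m ^ 2 * η)) := by
  set h := synth ψ m (galerkinCoeffs ψ m (covOp P X) β) with hh
  have hG := hX.posDef_truncMatrix ψ m
  have hY4 := hY.memLp_four hη hX hε
  have hY2 : MemLp Y 2 P := hY4.mono_exponent (by norm_num)
  have hYm := hY4.aestronglyMeasurable.aemeasurable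
  have hYX : AEMeasurable (fun w => (Y w, X w)) P := hYm.prodMk hX.aemeasurable
  have : IsProbabilityMeasure (P.map fun w => (Y w, X w)) := Measure.isProbabilityMeasure_map hYX
  have hz := hX.isotropic_standardize hη hYm m
  have hh4 := (hX.memLp_inner_four hη h).1
  set a := invSqrt (truncMatrix ψ m (covOp P X)) *ᵥ coeffs ψ m (covOp P X β) with ha
  have haz : ∀ e : ℝ × H, a ⬝ᵥ standardize P ψ m X e = inner ℝ h e.2 := fun e => by
    rw [standardize, ← invSqrt_mulVec_dotProduct, ha, mulVec_mulVec, ← inv_eq_invSqrt_mul hG,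
      hh, inner_synth]
    rfl
  have haa : ∫ w, inner ℝ h (X w) ^ 2 ∂P = a ⬝ᵥ a := by
    rw [← hz.integral_dotProduct_sq a,
      integral_map hYX ((hz.measurable_dotProduct a).pow_const 2).aestronglyMeasurable]
    simp only [haz]
  have ha4 : ∫ w, inner ℝ h (X w) ^ 4 ∂P ≤ (a ⬝ᵥ a) ^ 2 * (m ^ 2 * η) := by
    refine le_trans (le_of_eq ?_) (hz.integral_dotProduct_pow_four_le a)
    rw [integral_map hYX ((hz.measurable_dotProduct a).pow_const 4).aestronglyMeasurable]
    simp only [haz]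
  have hYh : MemLp (fun w => Y w - inner ℝ h (X w)) 2 P := hY2.sub (hX.memLp_inner h)
  have hle : a ⬝ᵥ a ≤ ∫ w, Y w ^ 2 ∂P := by
    have h0 := hY.integral_residual_mul_inner hη hX hε m (galerkinCoeffs ψ m (covOp P X) β)
    rw [← hh] at h0
    have h1 : ∀ w, Y w ^ 2 = (Y w - inner ℝ h (X w)) ^ 2
        + 2 * ((Y w - inner ℝ h (X w)) * inner ℝ h (X w)) + inner ℝ h (X w) ^ 2 := fun w => by
      ring
    have h2 : Integrable (fun w => 2 * ((Y w - inner ℝ h (X w)) * inner ℝ h (X w))) P :=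
      (hYh.integrable_mul (hX.memLp_inner h)).const_mul 2
    simp only [h1]
    have h3 : Integrable (fun w => (Y w - inner ℝ h (X w)) ^ 2
        + 2 * ((Y w - inner ℝ h (X w)) * inner ℝ h (X w))) P := hYh.integrable_sq.add h2
    rw [integral_add h3 (hX.memLp_inner h).integrable_sq,
      integral_add hYh.integrable_sq h2, integral_const_mul, h0, haa]
    have : 0 ≤ ∫ w, (Y w - inner ℝ h (X w)) ^ 2 ∂P := integral_nonneg fun _ => sq_nonneg _
    linarith
  have haa0 := dotProduct_self_nonneg' a
  have h5 := integral_add_pow_four_le hY4 hh4.neg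
  simp only [Pi.neg_apply, ← sub_eq_add_neg, (by decide : Even 4).neg_pow] at h5
  refine h5.trans ?_
  gcongr
  exact ha4.trans (by gcongr)

end Galerkin

end Moments

/-! ### A risk bound for fixed `n` and `m`. -/

section RiskBound

open Matrix

variable {Ω : Type*} [MeasurableSpace Ω] {P : Measure Ω}
  {H : Type*} [NormedAddCommGroup H] [InnerProductSpace ℝ H] [CompleteSpace H]
  [MeasurableSpace H] [BorelSpace H] [SecondCountableTopology H]
  {ψ : HilbertBasis ℕ ℝ H} {X : Ω → H} {Y ε : Ω → ℝ} {η σ : ℝ} {β : H} {ω : ℕ → ℝ} {m : ℕ}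

/-- The residual `y - ⟨b, x⟩` of the pair `e = (y, x)` for the coefficient vector `b`. -/
noncomputable def residual (ψ : HilbertBasis ℕ ℝ H) (b : Fin m → ℝ) (e : ℝ × H) : ℝ :=
  e.1 - b ⬝ᵥ coeffs ψ m e.2

/-- The squared Euclidean norm of the residual times the coefficient vector. -/
noncomputable def scoreSq (ψ : HilbertBasis ℕ ℝ H) (b : Fin m → ℝ) (e : ℝ × H) : ℝ :=
  residual ψ b e ^ 2 * (coeffs ψ m e.2 ⬝ᵥ coeffs ψ m e.2)

/-- The average of the residuals times the standardised coefficient vectors. -/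
noncomputable def stdScore (P : Measure Ω) (ψ : HilbertBasis ℕ ℝ H) (X : Ω → H) (n : ℕ)
    (b : Fin m → ℝ) (e : ℕ → ℝ × H) : Fin m → ℝ :=
  (n : ℝ)⁻¹ • ∑ i ∈ Finset.range n, residual ψ b (e i) • standardize P ψ m X (e i)

omit [CompleteSpace H] [MeasurableSpace H] [BorelSpace H] [SecondCountableTopology H] in
lemma scoreSq_nonneg (b : Fin m → ℝ) (e : ℝ × H) : 0 ≤ scoreSq ψ b e :=
  mul_nonneg (sq_nonneg _) (dotProduct_self_nonneg' _)

omit [CompleteSpace H] [SecondCountableTopology H] in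
lemma measurable_residual (b : Fin m → ℝ) : Measurable (residual ψ b) := by
  refine measurable_fst.sub (Finset.measurable_sum _ fun j _ => Measurable.const_mul ?_ _)
  exact (measurable_pi_apply j).comp ((measurable_coeffs ψ m).comp measurable_snd)

omit [CompleteSpace H] [SecondCountableTopology H] in
lemma measurable_scoreSq (b : Fin m → ℝ) : Measurable (scoreSq ψ b) := by
  have h : ∀ j, Measurable fun e : ℝ × H => coeffs ψ m e.2 j := fun j =>
    (measurable_pi_apply j).comp ((measurable_coeffs ψ m).comp measurable_snd)
  exact ((measurable_residual b).pow_const 2).mul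
    (Finset.measurable_sum _ fun j _ => (h j).mul (h j))

lemma Isotropic.measurableSet_deviationSet {E : Type*} [MeasurableSpace E] {μ : Measure E}
    {z : E → Fin m → ℝ} (hz : Isotropic μ z η) (n i : ℕ) :
    MeasurableSet (deviationSet μ z η n i) := by
  have h : deviationSet μ z η n i = ⋃ k : Fin m × Fin m × Bool, {e : ℕ → E | (n : ℝ) / (8 * m) ≤
      ∑ l ∈ (Finset.range n).erase i, (truncEntry z (4 * m ^ 2 * η) k (e l)
        - ∫ e', truncEntry z (4 * m ^ 2 * η) k e' ∂μ)} := by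
    ext; simp [deviationSet]
  rw [h]
  refine MeasurableSet.iUnion fun k => measurableSet_le measurable_const ?_
  exact Finset.measurable_sum _ fun l _ =>
    ((hz.measurable_truncEntry _ k).comp (measurable_pi_apply l)).sub_const _

/-- The law of the pair `(Y, X)`. -/
noncomputable abbrev pairLaw (P : Measure Ω) (X : Ω → H) (Y : Ω → ℝ) : Measure (ℝ × H) :=
  P.map fun w => (Y w, X w)

variable [IsProbabilityMeasure P]

lemma quadratic_le_of_notMem_deviationSet (hη : 0 < η) (hX : MemXMoment P ψ 4 η X)
    (hY : AEMeasurable Y P) (hm : 0 < m) {n i : ℕ} (hn : 6 ≤ n) (hi : i < n) {e : ℕ → ℝ × H}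
    (he : e ∉ deviationSet (pairLaw P X Y) (standardize P ψ m X) η n i) (v : Fin m → ℝ) :
    v ⬝ᵥ truncMatrix ψ m (covOp P X) *ᵥ v
      ≤ 2 * (v ⬝ᵥ truncMatrix ψ m (empCov n fun i => (e i).2) *ᵥ v) := by
  have : IsProbabilityMeasure (pairLaw P X Y) :=
    Measure.isProbabilityMeasure_map (hY.prodMk hX.aemeasurable)
  obtain ⟨y, h1, h2, -⟩ := exists_invSqrt_mulVec_eq (hX.posDef_truncMatrix ψ m) v
  have h := (hX.isotropic_standardize hη.le hY m).dotProduct_self_le_of_notMem_deviationSet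
    hη hm hn hi he y
  rw [h2, dotProduct_truncMatrix_empCov]
  simpa only [standardize, ← invSqrt_mulVec_dotProduct, h1] using h

lemma wnormSq_estimator_sub_le (hω : ∀ j, 0 < ω j) (hη : 0 < η) (hX : MemXMoment P ψ 4 η X)
    (hY : AEMeasurable Y P) (hm : 0 < m) {n : ℕ} (hn : 6 ≤ n) {γ : ℝ}
    (hγ : 2 * specNorm (truncMatrix ψ m (covOp P X))⁻¹ ≤ γ) (b : Fin m → ℝ) (e : ℕ → ℝ × H) :
    wnormSq ψ ω (estimator ψ n m γ (fun i => (e i).1) (fun i => (e i).2) - β)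
      ≤ 2 * wnormSq ψ ω (synth ψ m b - β)
        + wnormSq ψ ω β *
          (deviationSet (pairLaw P X Y) (standardize P ψ m X) η n 0).indicator 1 e
        + 2 * ENNReal.ofReal ((⨆ j : Fin m, ω j) *
            (4 * specNorm (truncMatrix ψ m (covOp P X))⁻¹)) *
          ENNReal.ofReal (stdScore P ψ X n b e ⬝ᵥ stdScore P ψ X n b e)
        + 2 * ENNReal.ofReal ((⨆ j : Fin m, ω j) * γ ^ 2 * (n : ℝ)⁻¹) *
          ∑ i ∈ Finset.range n, ENNReal.ofReal (scoreSq ψ b (e i)) *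
            (deviationSet (pairLaw P X Y) (standardize P ψ m X) η n i).indicator 1 e := by
  classical
  have hG := hX.posDef_truncMatrix ψ m
  set G := truncMatrix ψ m (covOp P X) with hGdef
  set A := truncMatrix ψ m (empCov n fun i => (e i).2) with hA
  set B := deviationSet (pairLaw P X Y) (standardize P ψ m X) η n with hB
  set s := ⨆ j : Fin m, ω j with hs
  have hs0 : 0 ≤ s := Real.iSup_nonneg fun j => (hω j).le
  set T := score n b (fun i => (e i).1) (fun i => coeffs ψ m (e i).2) with hT
  have hsub : IsUnit A.det → A⁻¹ *ᵥ coeffs ψ m (empG n (fun i => (e i).1) fun i => (e i).2)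
      = A⁻¹ *ᵥ T + b := fun hu => by
    rw [hT, ← coeffs_empG_sub, mulVec_sub, mulVec_mulVec, ← hA, nonsing_inv_mul _ hu,
      one_mulVec, sub_add_cancel]
  have hpass : IsUnit A.det → specNorm A⁻¹ ≤ γ →
      wnormSq ψ ω (estimator ψ n m γ (fun i => (e i).1) (fun i => (e i).2) - β)
        ≤ 2 * wnormSq ψ ω (synth ψ m b - β)
          + 2 * ENNReal.ofReal (s * ((A⁻¹ *ᵥ T) ⬝ᵥ (A⁻¹ *ᵥ T))) := fun hu hle => by
    rw [estimator, if_pos ⟨hu, hle⟩, hsub hu, synth_add, add_sub_assoc, add_comm (2 * _)]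
    refine (wnormSq_add_le ψ hω _ _).trans ?_
    gcongr
    exact wnormSq_synth_le ψ hω m _
  -- Avoiding a single `B i` already gives `G ≤ 2A`. Otherwise all the `B i` occur, and each
  -- contribution may carry the indicator of its own event.
  by_cases hgood : ∃ i < n, e ∉ B i
  · obtain ⟨i, hi, hei⟩ := hgood
    have hq := quadratic_le_of_notMem_deviationSet hη hX hY hm hn hi hei
    have hstd : invSqrt G *ᵥ T = stdScore P ψ X n b e := by
      rw [hT, score, stdScore, mulVec_smul, mulVec_sum]
      simp only [mulVec_smul]
      rfl
    have h1 := mulVec_inv_dotProduct_self_le hG hq T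
    rw [hstd] at h1
    refine (hpass (isUnit_det_of_le hG hq) ((specNorm_inv_le hG hq).trans hγ)).trans ?_
    refine le_add_right ?_
    rw [add_right_comm]
    refine le_add_right (add_le_add le_rfl ?_)
    rw [mul_assoc 2]
    gcongr
    rw [← ENNReal.ofReal_mul (by have := specNorm_nonneg G⁻¹; positivity)]
    refine ENNReal.ofReal_le_ofReal ?_
    rw [mul_assoc]
    gcongr
  · push Not at hgood
    by_cases hp : IsUnit A.det ∧ specNorm A⁻¹ ≤ γ
    · refine (hpass hp.1 hp.2).trans ?_
      rw [add_assoc, add_assoc]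
      gcongr
      refine le_add_left (le_add_left ?_)
      rw [mul_assoc]
      gcongr
      have h1 : ∑ i ∈ Finset.range n, ENNReal.ofReal (scoreSq ψ b (e i)) *
          (B i).indicator 1 e = ENNReal.ofReal (∑ i ∈ Finset.range n, scoreSq ψ b (e i)) := by
        rw [ENNReal.ofReal_sum_of_nonneg fun i _ => scoreSq_nonneg b _]
        refine Finset.sum_congr rfl fun i hi => ?_
        rw [Set.indicator_of_mem (hgood i (Finset.mem_range.1 hi))]
        simp
      rw [h1, ← ENNReal.ofReal_mul (by positivity)]
      refine ENNReal.ofReal_le_ofReal ?_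
      rw [mul_assoc, mul_assoc]
      gcongr
      have h2 := mulVec_dotProduct_self_le A⁻¹ T
      have h3 := score_dotProduct_self_le n b (fun i => (e i).1) fun i => coeffs ψ m (e i).2
      have h4 := specNorm_nonneg A⁻¹
      have h5 := dotProduct_self_nonneg' T
      calc _ ≤ _ := h2
        _ ≤ γ ^ 2 * (T ⬝ᵥ T) := by gcongr; exact hp.2
        _ ≤ _ := by
          gcongr
          exact h3
    -- The estimator is `0` and the error is `β`; any one of the events could carry it, and `B 0` is
    -- taken.
    · rw [estimator, if_neg hp, zero_sub, wnormSq_neg]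
      refine le_add_right (le_add_right (le_add_left ?_))
      rw [Set.indicator_of_mem (hgood 0 (by omega))]
      simp

omit [IsProbabilityMeasure P] in
lemma lintegral_scoreSq_le (hη : 0 ≤ η) (hX : MemXMoment P ψ 4 η X)
    (hY : MemLp Y 4 P) (b : Fin m → ℝ) {K : ℝ}
    (hK : ∫ w, (Y w - inner ℝ (synth ψ m b) (X w)) ^ 4 ∂P ≤ K) :
    ∫⁻ e, ENNReal.ofReal (scoreSq ψ b e) ∂pairLaw P X Y
      ≤ ENNReal.ofReal (m * ((K + η * (∫ w, ‖X w‖ ^ 2 ∂P) ^ 2) / 2)) := by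
  have hYX : AEMeasurable (fun w => (Y w, X w)) P :=
    hY.aestronglyMeasurable.aemeasurable.prodMk hX.aemeasurable
  have hu : MemLp (fun w => Y w - inner ℝ (synth ψ m b) (X w)) 4 P :=
    hY.sub (hX.memLp_inner_four hη _).1
  have hx := fun j : Fin m => hX.memLp_inner_four hη (ψ j)
  have hpt : ∀ w, scoreSq ψ b (Y w, X w) = ∑ j : Fin m,
      ((Y w - inner ℝ (synth ψ m b) (X w)) * inner ℝ (ψ j) (X w)) ^ 2 := fun w => by
    have hc : ∀ f, inner ℝ (X w) f = inner ℝ f (X w) := fun f => real_inner_comm _ _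
    rw [scoreSq, residual, inner_synth]
    simp only [dotProduct]
    rw [Finset.mul_sum]
    refine Finset.sum_congr rfl fun j _ => ?_
    simp only [coeffs, hc]
    ring
  rw [lintegral_map' (measurable_scoreSq b).ennreal_ofReal.aemeasurable hYX]
  simp only [hpt]
  have hi : ∀ j : Fin m, Integrable (fun w =>
      ((Y w - inner ℝ (synth ψ m b) (X w)) * inner ℝ (ψ j) (X w)) ^ 2) P := fun j =>
    (memLp_two_mul hu (hx j).1).integrable_sq
  rw [← ofReal_integral_eq_lintegral_ofReal (integrable_finsetSum _ fun j _ => hi j)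
    (Eventually.of_forall fun w => Finset.sum_nonneg fun j _ => sq_nonneg _),
    integral_finsetSum _ fun j _ => hi j]
  refine ENNReal.ofReal_le_ofReal ?_
  calc _ ≤ ∑ _j : Fin m, (K + η * (∫ w, ‖X w‖ ^ 2 ∂P) ^ 2) / 2 := by
        refine Finset.sum_le_sum fun j _ => ?_
        have h1 := integral_sq_mul_sq_le hu (hx j).1 one_pos
        have h2 := (hx j).2
        rw [ψ.orthonormal.norm_eq_one] at h2
        linarith
    _ = _ := by simp

lemma lintegral_wnormSq_estimator_sub_le (hω : ∀ j, 0 < ω j) (hη : 0 < η)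
    (hX : MemXMoment P ψ 4 η X) (hε : MemE P 4 η ε) (hY : LinearModel P β σ X ε Y)
    {D : ℕ → Ω → ℝ × H} (hD : ∀ i, Measurable (D i)) (hind : iIndepFun D P)
    (hlaw : ∀ i, P.map (D i) = pairLaw P X Y)
    (hm : 0 < m) {n : ℕ} (hn : 6 ≤ n) {γ : ℝ}
    (hγ : 2 * specNorm (truncMatrix ψ m (covOp P X))⁻¹ ≤ γ) {K c : ℝ} (hc : 0 < c)
    (hK : ∫ w, (Y w - inner ℝ (synth ψ m (galerkinCoeffs ψ m (covOp P X) β)) (X w)) ^ 4 ∂P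
      ≤ K) :
    ∫⁻ w, wnormSq ψ ω
        (estimator ψ n m γ (fun i => (D i w).1) (fun i => (D i w).2) - β) ∂P
      ≤ 2 * wnormSq ψ ω (synth ψ m (galerkinCoeffs ψ m (covOp P X) β) - β)
        + wnormSq ψ ω β * ENNReal.ofReal (deviationBound η n m)
        + 2 * ENNReal.ofReal ((⨆ j : Fin m, ω j) * (2 * γ)) *
          ENNReal.ofReal ((n : ℝ)⁻¹ * (m * ((K / c + c * η) / 2)))
        + 2 * ENNReal.ofReal ((⨆ j : Fin m, ω j) * γ ^ 2) *
          ENNReal.ofReal (m * ((K + η * (∫ w, ‖X w‖ ^ 2 ∂P) ^ 2) / 2)) *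
          ENNReal.ofReal (deviationBound η n m) := by
  have hY4 := hY.memLp_four hη.le hX hε
  have hYm := hY4.aestronglyMeasurable.aemeasurable
  have hYX : AEMeasurable (fun w => (Y w, X w)) P := hYm.prodMk hX.aemeasurable
  have : IsProbabilityMeasure (pairLaw P X Y) := Measure.isProbabilityMeasure_map hYX
  have hz := hX.isotropic_standardize hη.le hYm m
  set b := galerkinCoeffs ψ m (covOp P X) β with hb
  set z := standardize P ψ m X with hzdef
  set s := ⨆ j : Fin m, ω j with hs
  have hs0 : 0 ≤ s := Real.iSup_nonneg fun j => (hω j).le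
  have hn0 : (0 : ℝ) < n := by exact_mod_cast (by omega : 0 < n)
  have hDpi : Measurable fun w l => D l w := measurable_pi_lambda _ hD
  have hind1 : ∀ i, Measurable fun w =>
      (deviationSet (pairLaw P X Y) z η n i).indicator (1 : (ℕ → ℝ × H) → ℝ≥0∞)
        fun l => D l w := fun i =>
    (measurable_one.indicator (hz.measurableSet_deviationSet n i)).comp hDpi
  have hmz : ∀ i j, Measurable fun w => z (D i w) j := fun i j =>
    (hz.measurable_apply j).comp (hD i)
  have hmu : ∀ i, Measurable fun w => residual ψ b (D i w) := fun i =>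
    (measurable_residual b).comp (hD i)
  have hres : ∀ w, residual ψ b (Y w, X w) = Y w - inner ℝ (synth ψ m b) (X w) := fun w => by
    rw [inner_synth]; rfl
  have hu4 : MemLp (residual ψ b) 4 (pairLaw P X Y) := by
    rw [memLp_map_measure_iff (measurable_residual b).aestronglyMeasurable hYX]
    refine (hY4.sub (hX.memLp_inner_four hη.le (synth ψ m b)).1).ae_eq
      (Eventually.of_forall fun w => (hres w).symm)
  have huK : ∫ e, residual ψ b e ^ 4 ∂pairLaw P X Y ≤ K := by
    rw [integral_map hYX ((measurable_residual b).pow_const 4).aestronglyMeasurable]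
    simpa only [hres] using hK
  have huz : ∀ j, ∫ e, residual ψ b e * z e j ∂pairLaw P X Y = 0 := fun j => by
    have hmm : Measurable fun e => residual ψ b e * z e j :=
      (measurable_residual b).mul (hz.measurable_apply j)
    rw [integral_map hYX hmm.aestronglyMeasurable]
    simp only [hres, hzdef, standardize, mulVec_coeffs_apply]
    exact hY.integral_residual_mul_inner hη.le hX hε m _
  have hscore : Measurable fun w => stdScore P ψ X n b (fun l => D l w) ⬝ᵥ
      stdScore P ψ X n b (fun l => D l w) := by
    simp only [stdScore, dotProduct, Pi.smul_apply, Finset.sum_apply, smul_eq_mul]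
    simp only [hzdef] at hmz
    fun_prop
  have h1 := hz.lintegral_score_le hD hind hlaw (measurable_residual b) hu4 huz huK hc n
  have h2 : ∀ i, ∫⁻ w, ENNReal.ofReal (scoreSq ψ b (D i w)) *
      (deviationSet (pairLaw P X Y) z η n i).indicator 1 (fun l => D l w) ∂P
      ≤ ENNReal.ofReal (m * ((K + η * (∫ w, ‖X w‖ ^ 2 ∂P) ^ 2) / 2)) *
        ENNReal.ofReal (deviationBound η n m) := fun i => by
    refine (hz.lintegral_mul_indicator_deviationSet_le hη hm hD hind hlaw
      (measurable_scoreSq b).ennreal_ofReal n i).trans ?_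
    gcongr
    exact lintegral_scoreSq_le hη.le hX hY4 b hK
  have h3 : ∫⁻ w, (deviationSet (pairLaw P X Y) z η n 0).indicator 1 (fun l => D l w) ∂P
      ≤ ENNReal.ofReal (deviationBound η n m) := by
    simpa using hz.lintegral_mul_indicator_deviationSet_le hη hm hD hind hlaw
      (f := fun _ => 1) measurable_const n 0
  have hms : ∀ i, Measurable fun w => ENNReal.ofReal (scoreSq ψ b (D i w)) *
      (deviationSet (pairLaw P X Y) z η n i).indicator 1 (fun l => D l w) := fun i =>
    ((measurable_scoreSq b).comp (hD i)).ennreal_ofReal.mul (hind1 i)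
  refine (lintegral_mono fun w => wnormSq_estimator_sub_le hω hη hX hYm hm hn hγ b
    fun l => D l w).trans ?_
  rw [lintegral_add_right _ ((Finset.measurable_sum _ fun i _ => hms i).const_mul _),
    lintegral_add_right _ (hscore.ennreal_ofReal.const_mul _),
    lintegral_add_right _ ((hind1 0).const_mul _), lintegral_const, measure_univ, mul_one,
    lintegral_const_mul _ (hind1 0), lintegral_const_mul _ hscore.ennreal_ofReal,
    lintegral_const_mul _ (Finset.measurable_sum _ fun i _ => hms i),
    lintegral_finsetSum _ fun i _ => hms i]
  refine add_le_add (add_le_add (add_le_add le_rfl (by gcongr)) ?_) ?_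
  · refine mul_le_mul' ?_ h1
    -- The factor `4‖G⁻¹‖` is at most `2γ`.
    rw [show (4 : ℝ) = 2 * 2 by norm_num, mul_assoc (2 : ℝ) 2]
    gcongr
  · calc _ ≤ 2 * ENNReal.ofReal (s * γ ^ 2 * (n : ℝ)⁻¹) * ∑ _i ∈ Finset.range n,
          ENNReal.ofReal (m * ((K + η * (∫ w, ‖X w‖ ^ 2 ∂P) ^ 2) / 2)) *
            ENNReal.ofReal (deviationBound η n m) := by
          gcongr with i
          exact h2 i
      _ = 2 * (ENNReal.ofReal (s * γ ^ 2 * (n : ℝ)⁻¹) * n) *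
          ENNReal.ofReal (m * ((K + η * (∫ w, ‖X w‖ ^ 2 ∂P) ^ 2) / 2)) *
            ENNReal.ofReal (deviationBound η n m) := by
          rw [Finset.sum_const, Finset.card_range, nsmul_eq_mul]
          ring
      _ = _ := by
          rw [← ENNReal.ofReal_natCast n, ← ENNReal.ofReal_mul (by positivity),
            inv_mul_cancel_right₀ hn0.ne']

end RiskBound

/-! ### Consequences of the growth conditions on `m` and `γ`. -/

section Rates

/-- From `exp u ≥ u⁶⁰ / 60!`: raising `x¹⁰ ≤ C y³` to the power `18` turns `(y / x³)⁶⁰` into at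
least `y⁶ / C¹⁸`. The power `y⁶` is what `tendsto_mul_deviationBound` needs. -/
lemma exp_neg_div_le {a C x y : ℝ} (ha : 0 < a) (hx : 0 < x) (hy : 0 < y)
    (h : x ^ 10 ≤ C * y ^ 3) :
    Real.exp (-(y / (a * x ^ 3))) ≤ (Nat.factorial 60 * a ^ 60 * C ^ 18) / y ^ 6 := by
  have hf : (0 : ℝ) < Nat.factorial 60 := by exact_mod_cast Nat.factorial_pos 60
  have h1 := Real.pow_div_factorial_le_exp (y / (a * x ^ 3)) (by positivity) 60
  have h2 : (x ^ 10) ^ 18 ≤ (C * y ^ 3) ^ 18 := by gcongr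
  generalize (Nat.factorial 60 : ℝ) = F at *
  rw [Real.exp_neg]
  calc (Real.exp (y / (a * x ^ 3)))⁻¹ ≤ ((y / (a * x ^ 3)) ^ 60 / F)⁻¹ := by gcongr
    _ = F * a ^ 60 * (x ^ 10) ^ 18 / y ^ 60 := by field_simp
    _ ≤ F * a ^ 60 * (C * y ^ 3) ^ 18 / y ^ 60 := by gcongr
    _ = _ := by field_simp

variable {m : ℕ → ℕ} {γ : ℕ → ℝ}

lemma exists_pow_four_mul_le
    (hγO : (fun n : ℕ => γ n ^ 2 * ((m n : ℝ) ^ 3 / (n : ℝ) ^ (1 + 1 / 2 : ℝ)))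
      =O[atTop] (fun _ => (1 : ℝ))) :
    ∃ C : ℝ, 0 < C ∧ ∀ᶠ n : ℕ in atTop, γ n ^ 4 * (m n : ℝ) ^ 6 ≤ C * (n : ℝ) ^ 3 := by
  obtain ⟨c, hc, h⟩ := hγO.exists_pos
  refine ⟨c ^ 2, by positivity, ?_⟩
  filter_upwards [h.bound, eventually_gt_atTop 0] with n hn hn0
  have hn' : (0 : ℝ) < n := by exact_mod_cast hn0
  have hr : ((n : ℝ) ^ (1 + 1 / 2 : ℝ)) ^ 2 = (n : ℝ) ^ 3 := by
    rw [← Real.rpow_natCast, ← Real.rpow_mul hn'.le]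
    norm_num
  have hr0 : 0 < (n : ℝ) ^ (1 + 1 / 2 : ℝ) := Real.rpow_pos_of_pos hn' _
  rw [norm_one, mul_one, Real.norm_eq_abs] at hn
  have h1 : (γ n ^ 2 * ((m n : ℝ) ^ 3 / (n : ℝ) ^ (1 + 1 / 2 : ℝ))) ^ 2 ≤ c ^ 2 :=
    sq_le_sq.2 (hn.trans (le_abs_self c))
  have h2 : (γ n ^ 2 * ((m n : ℝ) ^ 3 / (n : ℝ) ^ (1 + 1 / 2 : ℝ))) ^ 2
      = γ n ^ 4 * (m n : ℝ) ^ 6 / (n : ℝ) ^ 3 := by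
    rw [← hr]; field_simp
  rw [h2, div_le_iff₀ (by positivity)] at h1
  exact h1

/-- The fourth power is `γ⁴m⁶ · m² / n⁴ ≤ C m² / n`. -/
lemma tendsto_mul_sq_div (hγ0 : ∀ n, 0 ≤ γ n)
    (hmn : Tendsto (fun n : ℕ => (m n : ℝ) ^ 2 / n) atTop (𝓝 0)) {C : ℝ}
    (hC : ∀ᶠ n : ℕ in atTop, γ n ^ 4 * (m n : ℝ) ^ 6 ≤ C * (n : ℝ) ^ 3) :
    Tendsto (fun n : ℕ => γ n * ((m n : ℝ) ^ 2 / n)) atTop (𝓝 0) := by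
  have h1 : Tendsto (fun n : ℕ => Real.sqrt (Real.sqrt (C * ((m n : ℝ) ^ 2 / n)))) atTop (𝓝 0) := by
    have := ((hmn.const_mul C).sqrt).sqrt
    simpa using this
  refine tendsto_of_tendsto_of_tendsto_of_le_of_le' tendsto_const_nhds h1
    (Eventually.of_forall fun n => by have := hγ0 n; positivity) ?_
  filter_upwards [hC, eventually_gt_atTop 0] with n hn hn0
  have hn' : (0 : ℝ) < n := by exact_mod_cast hn0
  refine Real.le_sqrt_of_sq_le (Real.le_sqrt_of_sq_le ?_)
  calc ((γ n * ((m n : ℝ) ^ 2 / n)) ^ 2) ^ 2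
      = (γ n ^ 4 * (m n : ℝ) ^ 6) * (m n : ℝ) ^ 2 / (n : ℝ) ^ 4 := by field_simp
    _ ≤ (C * (n : ℝ) ^ 3) * (m n : ℝ) ^ 2 / (n : ℝ) ^ 4 := by gcongr
    _ = C * ((m n : ℝ) ^ 2 / n) := by field_simp

/-- Multiplying `(2m)⁴ ≤ (γτ)⁴` by `m⁶` gives `16 m¹⁰ ≤ τ⁴ γ⁴ m⁶ ≤ τ⁴ C n³`. -/
lemma exists_deviationBound_le {η τ C : ℝ} (hη : 0 < η) (hγτ : ∀ n, 2 * (m n : ℝ) ≤ γ n * τ)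
    (hm : Tendsto m atTop atTop)
    (hC : ∀ᶠ n : ℕ in atTop, γ n ^ 4 * (m n : ℝ) ^ 6 ≤ C * (n : ℝ) ^ 3) :
    ∃ C' : ℝ, 0 ≤ C' ∧
      ∀ᶠ n : ℕ in atTop, deviationBound η n (m n) ≤ C' * (m n : ℝ) ^ 2 / (n : ℝ) ^ 6 := by
  refine ⟨2 * (Nat.factorial 60 * (256 * η) ^ 60 * (τ ^ 4 * C / 16) ^ 18), by positivity, ?_⟩
  filter_upwards [hC, eventually_gt_atTop 0, hm.eventually_gt_atTop 0] with n hn hn0 hm0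
  have hn' : (0 : ℝ) < n := by exact_mod_cast hn0
  have hm' : (0 : ℝ) < m n := by exact_mod_cast hm0
  have h1 : (2 * (m n : ℝ)) ^ 4 ≤ (γ n * τ) ^ 4 := by
    have := hγτ n
    gcongr
  have h2 : (m n : ℝ) ^ 10 ≤ (τ ^ 4 * C / 16) * (n : ℝ) ^ 3 := by
    have h3 : (2 * (m n : ℝ)) ^ 4 * (m n : ℝ) ^ 6 ≤ (γ n * τ) ^ 4 * (m n : ℝ) ^ 6 := by gcongr
    have h4 : τ ^ 4 * (γ n ^ 4 * (m n : ℝ) ^ 6) ≤ τ ^ 4 * (C * (n : ℝ) ^ 3) := by gcongr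
    nlinarith
  have h3 := exp_neg_div_le (a := 256 * η) (by positivity) hm' hn' h2
  generalize (Nat.factorial 60 : ℝ) = F at *
  calc deviationBound η n (m n)
      ≤ 2 * (m n : ℝ) ^ 2 * ((F * (256 * η) ^ 60 * (τ ^ 4 * C / 16) ^ 18) / (n : ℝ) ^ 6) := by
        rw [deviationBound]; gcongr
    _ = _ := by ring

lemma tendsto_deviationBound {η C : ℝ}
    (hmn : Tendsto (fun n : ℕ => (m n : ℝ) ^ 2 / n) atTop (𝓝 0)) (hC0 : 0 ≤ C)
    (hC : ∀ᶠ n : ℕ in atTop, deviationBound η n (m n) ≤ C * (m n : ℝ) ^ 2 / (n : ℝ) ^ 6) :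
    Tendsto (fun n : ℕ => deviationBound η n (m n)) atTop (𝓝 0) := by
  have h1 := hmn.const_mul C
  rw [mul_zero] at h1
  refine tendsto_of_tendsto_of_tendsto_of_le_of_le' tendsto_const_nhds h1
    (Eventually.of_forall fun n => by rw [deviationBound]; positivity) ?_
  filter_upwards [hC, eventually_gt_atTop 0] with n hn hn0
  have hn' : (1 : ℝ) ≤ n := by exact_mod_cast hn0
  refine hn.trans ?_
  rw [← mul_div_assoc]
  gcongr
  exact le_self_pow₀ hn' (by norm_num)

/-- After splitting off the vanishing factor `γ (m/n) s`, there remains a multiple of `γ m⁴ n / n⁶`.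
It is bounded because `m² ≤ n` eventually and `γ ≤ 1 + γ⁴ ≤ (1 + C₀) n³`. -/
lemma tendsto_mul_deviationBound {η C C₀ a b : ℝ} {s l : ℕ → ℝ} (hs : ∀ n, 0 ≤ s n)
    (hγ0 : ∀ n, 0 ≤ γ n) (ha : 0 ≤ a) (hb : 0 ≤ b)
    (hl : ∀ᶠ n in atTop, 0 ≤ l n ∧ l n ≤ m n)
    (hm : Tendsto m atTop atTop)
    (hγm : Tendsto (fun n : ℕ => γ n * ((m n : ℝ) / n) * s n) atTop (𝓝 0))
    (hmn : Tendsto (fun n : ℕ => (m n : ℝ) ^ 2 / n) atTop (𝓝 0))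
    (hC₀ : 0 < C₀) (hγC : ∀ᶠ n : ℕ in atTop, γ n ^ 4 * (m n : ℝ) ^ 6 ≤ C₀ * (n : ℝ) ^ 3)
    (hC0 : 0 ≤ C)
    (hC : ∀ᶠ n : ℕ in atTop, deviationBound η n (m n) ≤ C * (m n : ℝ) ^ 2 / (n : ℝ) ^ 6) :
    Tendsto (fun n : ℕ => s n * γ n ^ 2 * (m n * ((a * l n ^ 2 + b) / 2)) *
      deviationBound η n (m n)) atTop (𝓝 0) := by
  have h1 := hγm.const_mul ((1 + C₀) * ((a + b) / 2) * C)
  rw [mul_zero] at h1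
  have hdev : ∀ n, 0 ≤ deviationBound η n (m n) := fun n => by rw [deviationBound]; positivity
  refine tendsto_of_tendsto_of_tendsto_of_le_of_le' tendsto_const_nhds h1 ?_ ?_
  · filter_upwards with n
    have := hdev n
    have := hs n
    positivity
  filter_upwards [hC, hγC, hl, eventually_gt_atTop 0, hm.eventually_gt_atTop 0,
    hmn.eventually_le_const one_pos] with n hn hn2 hln hn0 hm0 hmn1
  have hn' : (1 : ℝ) ≤ n := by exact_mod_cast hn0
  have hm' : (1 : ℝ) ≤ m n := by exact_mod_cast hm0
  have hm2 : (m n : ℝ) ^ 2 ≤ n := by rwa [div_le_one (by linarith)] at hmn1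
  have hsn := hs n
  have hgn := hγ0 n
  have hg : γ n ≤ (1 + C₀) * (n : ℝ) ^ 3 := by
    have h2 : γ n ^ 4 * 1 ≤ γ n ^ 4 * (m n : ℝ) ^ 6 := by
      gcongr
      exact one_le_pow₀ hm'
    have h3 : γ n ≤ 1 + γ n ^ 4 := by nlinarith [sq_nonneg (γ n ^ 2 - 1 / 2), sq_nonneg (γ n - 1)]
    have h4 : (1 : ℝ) ≤ (n : ℝ) ^ 3 := one_le_pow₀ hn'
    nlinarith
  have hab : (a * l n ^ 2 + b) / 2 ≤ (a + b) / 2 * (m n : ℝ) ^ 2 := by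
    have h2 : l n ^ 2 ≤ (m n : ℝ) ^ 2 := pow_le_pow_left₀ hln.1 hln.2 2
    have h3 : (1 : ℝ) ≤ (m n : ℝ) ^ 2 := one_le_pow₀ hm'
    nlinarith [mul_le_mul_of_nonneg_left h2 ha, mul_le_mul_of_nonneg_left h3 hb]
  have hab0 : 0 ≤ (a * l n ^ 2 + b) / 2 := by positivity
  calc s n * γ n ^ 2 * (m n * ((a * l n ^ 2 + b) / 2)) * deviationBound η n (m n)
      ≤ s n * γ n ^ 2 * (m n * ((a + b) / 2 * (m n : ℝ) ^ 2)) *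
          (C * (m n : ℝ) ^ 2 / (n : ℝ) ^ 6) := by
        gcongr
        exact hdev n
    _ = γ n * ((m n : ℝ) / n) * s n * (γ n * ((a + b) / 2) * C *
          (((m n : ℝ) ^ 2) ^ 2 * (n / (n : ℝ) ^ 6))) := by field_simp
    _ ≤ γ n * ((m n : ℝ) / n) * s n * ((1 + C₀) * (n : ℝ) ^ 3 * ((a + b) / 2) * C *
          ((n : ℝ) ^ 2 * (n / (n : ℝ) ^ 6))) := by gcongr
    _ = _ := by field_simp

end Rates

/-! ### Consistency from a growth rate of the residual fourth moment. -/

section Consistency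

open Matrix

variable {Ω : Type*} [MeasurableSpace Ω] {P : Measure Ω} [IsProbabilityMeasure P]
  {H : Type*} [NormedAddCommGroup H] [InnerProductSpace ℝ H] [CompleteSpace H]
  [MeasurableSpace H] [BorelSpace H]
  {ψ : HilbertBasis ℕ ℝ H} {X : Ω → H} {Y ε : Ω → ℝ} {η σ : ℝ} {β : H} {ω : ℕ → ℝ}
  {m : ℕ → ℕ} {γ : ℕ → ℝ}

omit [IsProbabilityMeasure P] in
lemma two_mul_card_le [SecondCountableTopology H] (hX : MemX P X)
    (hγ : ∀ n, 2 * specNorm (truncMatrix ψ (m n) (covOp P X))⁻¹ ≤ γ n) (n : ℕ) :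
    2 * (m n : ℝ) ≤ γ n * ∫ w, ‖X w‖ ^ 2 ∂P := by
  have h1 := card_le_specNorm_mul_trace (hX.posDef_truncMatrix ψ (m n))
  have h2 : ∑ j, truncMatrix ψ (m n) (covOp P X) j j ≤ ∫ w, ‖X w‖ ^ 2 ∂P := by
    simp only [truncMatrix, of_apply]
    rw [Fin.sum_univ_eq_sum_range (fun j => inner ℝ (covOp P X (ψ j)) (ψ j))]
    exact hX.sum_inner_covOp_le ψ _
  have h3 : 0 ≤ ∫ w, ‖X w‖ ^ 2 ∂P := integral_nonneg fun _ => by positivity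
  have h4 := specNorm_nonneg (truncMatrix ψ (m n) (covOp P X))⁻¹
  have h5 := hγ n
  calc 2 * (m n : ℝ) ≤ 2 * (specNorm (truncMatrix ψ (m n) (covOp P X))⁻¹ *
        ∫ w, ‖X w‖ ^ 2 ∂P) := by
        gcongr
        exact h1.trans (by gcongr)
    _ = 2 * specNorm (truncMatrix ψ (m n) (covOp P X))⁻¹ * ∫ w, ‖X w‖ ^ 2 ∂P := by ring
    _ ≤ _ := by gcongr

omit [CompleteSpace H] [MeasurableSpace H] [BorelSpace H] in
lemma ofReal_mul_norm_sq_le_wnormSq {c : ℝ} (hc0 : 0 < c) (hc : ∀ j, c ≤ ω j) (f : H) :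
    ENNReal.ofReal (c * ‖f‖ ^ 2) ≤ wnormSq ψ ω f := by
  have h : HasSum (fun j => c * inner ℝ f (ψ j) ^ 2) (c * ‖f‖ ^ 2) := by
    have := (ψ.hasSum_inner_mul_inner f f).mul_left c
    simpa only [real_inner_comm f, ← sq, real_inner_self_eq_norm_sq] using this
  rw [wnormSq, ← h.tsum_eq, ENNReal.ofReal_tsum_of_nonneg (fun j => by positivity) h.summable]
  exact ENNReal.tsum_le_tsum fun j => ENNReal.ofReal_le_ofReal (by gcongr; exact hc j)

/-- The sequence `l` separates the two kinds of weights: it measures the growth of the residual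
fourth moment, and `hγl` says that the variance term can absorb it. -/
lemma tendsto_risk_of_residual_bound [SecondCountableTopology H] (hω : ∀ j, 0 < ω j)
    (hη : 0 < η) (hX : MemXMoment P ψ 4 η X) (hε : MemE P 4 η ε) (hY : LinearModel P β σ X ε Y)
    (hβ : wnormSq ψ ω β < ∞)
    {D : ℕ → Ω → ℝ × H} (hD : ∀ i, Measurable (D i)) (hind : iIndepFun D P)
    (hlaw : ∀ i, P.map (D i) = pairLaw P X Y)
    (hγ : ∀ n, 2 * specNorm (truncMatrix ψ (m n) (covOp P X))⁻¹ ≤ γ n)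
    (hm : Tendsto m atTop atTop)
    (hγm : Tendsto (fun n : ℕ => γ n * ((m n : ℝ) / n) * ⨆ j : Fin (m n), ω j) atTop (𝓝 0))
    (hmn : Tendsto (fun n : ℕ => (m n : ℝ) ^ 2 / n) atTop (𝓝 0)) {C₀ : ℝ} (hC₀ : 0 < C₀)
    (hγC : ∀ᶠ n : ℕ in atTop, γ n ^ 4 * (m n : ℝ) ^ 6 ≤ C₀ * (n : ℝ) ^ 3)
    (hbias : Tendsto (fun n => wnormSq ψ ω
      (synth ψ (m n) (galerkinCoeffs ψ (m n) (covOp P X) β) - β)) atTop (𝓝 0))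
    {l : ℕ → ℝ} (hl : ∀ᶠ n in atTop, 0 < l n ∧ l n ≤ m n)
    (hγl : Tendsto (fun n : ℕ => γ n * ((m n : ℝ) / n) * (⨆ j : Fin (m n), ω j) * l n)
      atTop (𝓝 0)) {C : ℝ} (hC : 0 ≤ C)
    (hres : ∀ᶠ n in atTop, ∫ w, (Y w -
        inner ℝ (synth ψ (m n) (galerkinCoeffs ψ (m n) (covOp P X) β)) (X w)) ^ 4 ∂P
      ≤ C * l n ^ 2) :
    Tendsto (fun n : ℕ => ∫⁻ w, wnormSq ψ ω
        (estimator ψ n (m n) (γ n) (fun i => (D i w).1) (fun i => (D i w).2) - β) ∂P)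
      atTop (𝓝 0) := by
  have hγ0 : ∀ n, 0 ≤ γ n := fun n => by
    have := specNorm_nonneg (truncMatrix ψ (m n) (covOp P X))⁻¹
    linarith [hγ n]
  have hs0 : ∀ n, 0 ≤ ⨆ j : Fin (m n), ω j := fun n => Real.iSup_nonneg fun j => (hω j).le
  obtain ⟨C₁, hC₁, hdev⟩ := exists_deviationBound_le hη (two_mul_card_le hX.toMemX hγ) hm hγC
  set τ := ∫ w, ‖X w‖ ^ 2 ∂P
  have hp := tendsto_deviationBound hmn hC₁ hdev
  have hp0 : ∀ n, 0 ≤ deviationBound η n (m n) := fun n => by rw [deviationBound]; positivity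
  have t1 : Tendsto (fun n => 2 * wnormSq ψ ω
      (synth ψ (m n) (galerkinCoeffs ψ (m n) (covOp P X) β) - β)) atTop (𝓝 0) := by
    simpa using ENNReal.Tendsto.const_mul hbias (Or.inr (by simp : (2 : ℝ≥0∞) ≠ ∞))
  have t2 : Tendsto (fun n => wnormSq ψ ω β * ENNReal.ofReal (deviationBound η n (m n)))
      atTop (𝓝 0) := by
    simpa using ENNReal.Tendsto.const_mul (ENNReal.tendsto_ofReal hp) (Or.inr hβ.ne)
  -- Here the balancing constant is `c = l n`, so the bracket is `l n (C + η) / 2`.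
  have t3 : Tendsto (fun n : ℕ => 2 * ENNReal.ofReal ((⨆ j : Fin (m n), ω j) * (2 * γ n)) *
      ENNReal.ofReal ((n : ℝ)⁻¹ * (m n * ((C * l n ^ 2 / l n + l n * η) / 2)))) atTop (𝓝 0) := by
    have h := ENNReal.tendsto_ofReal (hγl.const_mul (2 * (C + η)))
    rw [mul_zero, ENNReal.ofReal_zero] at h
    refine h.congr' ?_
    filter_upwards [hl] with n hn
    have h1 := hs0 n
    have h2 := hγ0 n
    have h3 := hn.1
    rw [← ENNReal.ofReal_ofNat 2, ← ENNReal.ofReal_mul (by norm_num),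
      ← ENNReal.ofReal_mul (by positivity)]
    congr 1
    field_simp
  have t4 : Tendsto (fun n : ℕ => 2 * ENNReal.ofReal ((⨆ j : Fin (m n), ω j) * γ n ^ 2) *
      ENNReal.ofReal (m n * ((C * l n ^ 2 + η * τ ^ 2) / 2)) *
        ENNReal.ofReal (deviationBound η n (m n))) atTop (𝓝 0) := by
    have h := ENNReal.tendsto_ofReal ((tendsto_mul_deviationBound (η := η) (a := C)
      (b := η * τ ^ 2) hs0 hγ0 hC (by positivity) (hl.mono fun n hn => ⟨hn.1.le, hn.2⟩) hm hγm
      hmn hC₀ hγC hC₁ hdev).const_mul 2)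
    rw [mul_zero, ENNReal.ofReal_zero] at h
    refine h.congr fun n => ?_
    have h1 := hs0 n
    have h2 := hγ0 n
    rw [← ENNReal.ofReal_ofNat 2, ← ENNReal.ofReal_mul (by norm_num),
      ← ENNReal.ofReal_mul (by positivity), ← ENNReal.ofReal_mul (by positivity)]
    congr 1
    ring
  have hsum := ((t1.add t2).add t3).add t4
  simp only [add_zero] at hsum
  refine tendsto_of_tendsto_of_tendsto_of_le_of_le' tendsto_const_nhds hsum
    (Eventually.of_forall fun _ => zero_le) ?_
  filter_upwards [hres, hl, eventually_ge_atTop 6, hm.eventually_gt_atTop 0] with n h1 h2 h3 h4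
  exact lintegral_wnormSq_estimator_sub_le hω hη hX hε hY hD hind hlaw h4 h3 (hγ n) h2.1 h1

end Consistency

end FLR

/-! ### Consistency for the two kinds of weights. -/

theorem proposition1
    {Ω : Type*} [MeasurableSpace Ω] (P : Measure Ω) [IsProbabilityMeasure P]
    -- the orthonormal basis and the weights
    (ψ : HilbertBasis ℕ ℝ FLR.L2I) (ω : ℕ → ℝ) (hω_pos : ∀ j, 0 < ω j)
    (hω : (∃ c : ℝ, 0 < c ∧ ∀ j, c ≤ ω j) ∨ (∃ C : ℝ, ∀ j, ω j ≤ C))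
    -- the model and the sample
    (β : FLR.L2I) (hβ : β ∈ FLR.weightedSpace ψ ω) (σ : ℝ) (hσ : 0 < σ) (η : ℝ) (hη : 1 ≤ η)
    (X : Ω → FLR.L2I) (hX : FLR.MemXMoment P ψ 4 η X)
    (ε : Ω → ℝ) (hε : FLR.MemE P 4 η ε)
    (Y : Ω → ℝ) (hY : FLR.LinearModel P β σ X ε Y)
    (Xs : ℕ → Ω → FLR.L2I) (Ys : ℕ → Ω → ℝ) (hsample : FLR.IsSample P X Y Xs Ys)
    -- the dimension and the threshold
    (m : ℕ → ℕ) (γ : ℕ → ℝ)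
    (hγ : ∀ n, 2 * FLR.specNorm (FLR.truncMatrix ψ (m n) (FLR.covOp P X))⁻¹ ≤ γ n)
    (hm : Tendsto m atTop atTop)
    (hγm : Tendsto (fun n : ℕ => γ n * ((m n : ℝ) / n) * ⨆ j : Fin (m n), ω j) atTop (𝓝 0))
    (hmn : Tendsto (fun n : ℕ => (m n : ℝ) ^ 2 / n) atTop (𝓝 0))
    (hγO : (fun n : ℕ => γ n ^ 2 * ((m n : ℝ) ^ 3 / (n : ℝ) ^ (1 + 1 / 2 : ℝ)))
      =O[atTop] (fun _ => (1 : ℝ)))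
    -- uniform boundedness of the operators
    (hΓ : ⨆ k : ℕ, FLR.wopNorm ψ ω (fun f =>
      FLR.truncInv ψ k (FLR.covOp P X)
        (FLR.proj ψ k (FLR.covOp P X (FLR.projPerp ψ k f)))) < ∞) :
    Tendsto (fun n : ℕ =>
      ∫⁻ w, FLR.wnormSq ψ ω
        (FLR.estimator ψ n (m n) (γ n) (fun i => Ys i w) (fun i => Xs i w) - β) ∂P)
      atTop (𝓝 0) := by
  have := FLR.secondCountableTopology_of_hilbertBasis ψ
  have hη0 : 0 < η := by linarith
  have hae : ∀ i, AEMeasurable (fun w => (Ys i w, Xs i w)) P := fun i =>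
    (hsample.ident i).aemeasurable_fst
  -- The sample is only almost everywhere measurable; it is replaced by measurable versions, which
  -- agree with it simultaneously for all `i` almost surely.
  have hD : ∀ᵐ w ∂P, ∀ i, (Ys i w, Xs i w) = (hae i).mk _ w :=
    ae_all_iff.2 fun i => (hae i).ae_eq_mk
  have hind : iIndepFun (fun i => (hae i).mk _) P :=
    hsample.indep.congr fun i => (hae i).ae_eq_mk
  have hlaw : ∀ i, P.map ((hae i).mk _) = FLR.pairLaw P X Y := fun i => by
    rw [← Measure.map_congr (hae i).ae_eq_mk, (hsample.ident i).map_eq]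
  have hcongr : ∀ n : ℕ, ∫⁻ w, FLR.wnormSq ψ ω (FLR.estimator ψ n (m n) (γ n)
        (fun i => ((hae i).mk _ w).1) (fun i => ((hae i).mk _ w).2) - β) ∂P
      = ∫⁻ w, FLR.wnormSq ψ ω
        (FLR.estimator ψ n (m n) (γ n) (fun i => Ys i w) (fun i => Xs i w) - β) ∂P := fun n => by
    refine lintegral_congr_ae ?_
    filter_upwards [hD] with w hw
    simp only [← hw]
  refine Tendsto.congr hcongr ?_
  obtain ⟨C₀, hC₀, hγC⟩ := FLR.exists_pow_four_mul_le hγO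
  have hγ0 : ∀ n, 0 ≤ γ n := fun n => by
    have := FLR.specNorm_nonneg (FLR.truncMatrix ψ (m n) (FLR.covOp P X))⁻¹
    linarith [hγ n]
  have hbias := (FLR.tendsto_wnormSq_synth_galerkinCoeffs_sub ψ hω_pos
    (fun k => (hX.posDef_truncMatrix ψ k).det_pos.ne'.isUnit) hΓ hβ).comp hm
  rcases hω with ⟨c, hc0, hc⟩ | ⟨C, hC⟩
  -- Weights bounded below: the weighted norm dominates `√c ‖·‖`. Once the weighted bias is at most
  -- `1`, the squared `L²` bias is at most `c⁻¹`, and the residual fourth moment stays bounded.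
  · refine FLR.tendsto_risk_of_residual_bound hω_pos hη0 hX hε hY hβ
      (fun i => (hae i).measurable_mk) hind hlaw hγ hm hγm hmn hC₀ hγC hbias
      (l := fun _ => 1) ?_ (by simpa using hγm)
      (C := 8 * (∫ w, (Y w - inner ℝ β (X w)) ^ 4 ∂P
        + η * (c⁻¹ ^ 2 * (∫ w, ‖X w‖ ^ 2 ∂P) ^ 2))) ?_ ?_
    · filter_upwards [hm.eventually_ge_atTop 1] with n hn
      exact ⟨one_pos, by exact_mod_cast hn⟩
    · have : 0 ≤ ∫ w, (Y w - inner ℝ β (X w)) ^ 4 ∂P := integral_nonneg fun _ => by positivity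
      positivity
    · filter_upwards [hbias.eventually_le_const one_pos] with n hn
      refine (hY.integral_residual_pow_four_le_norm hη0.le hX hε _).trans ?_
      have h1 := (FLR.ofReal_mul_norm_sq_le_wnormSq hc0 hc _).trans hn
      rw [ENNReal.ofReal_le_one, mul_comm, ← le_div_iff₀ hc0, one_div] at h1
      rw [one_pow, mul_one]
      gcongr
      rw [show ∀ x : ℝ, x ^ 4 = (x ^ 2) ^ 2 from fun x => by ring]
      gcongr
  -- Weights bounded above: nothing controls the `L²` bias, so the residual fourth moment may grow
  -- like `m²`, and `γ m² / n → 0` pays for it.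
  · refine FLR.tendsto_risk_of_residual_bound hω_pos hη0 hX hε hY hβ
      (fun i => (hae i).measurable_mk) hind hlaw hγ hm hγm hmn hC₀ hγC hbias
      (l := fun n => m n) ?_ ?_
      (C := 8 * (∫ w, Y w ^ 4 ∂P + (∫ w, Y w ^ 2 ∂P) ^ 2 * η)) ?_ ?_
    · filter_upwards [hm.eventually_gt_atTop 0] with n hn
      exact ⟨by exact_mod_cast hn, le_rfl⟩
    · have h1 := (FLR.tendsto_mul_sq_div hγ0 hmn hγC).mul_const C
      rw [zero_mul] at h1
      refine tendsto_of_tendsto_of_tendsto_of_le_of_le' tendsto_const_nhds h1 ?_ ?_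
      · filter_upwards with n
        have h2 := hγ0 n
        have h3 : 0 ≤ ⨆ j : Fin (m n), ω j := Real.iSup_nonneg fun j => (hω_pos j).le
        positivity
      · filter_upwards with n
        have h2 := hγ0 n
        have h3 : ⨆ j : Fin (m n), ω j ≤ C :=
          -- For `m n = 0` the supremum is `0` by convention, so `0 ≤ C` is needed as well.
          Real.iSup_le (fun j => hC j) ((hω_pos 0).le.trans (hC 0))
        calc γ n * ((m n : ℝ) / n) * (⨆ j : Fin (m n), ω j) * m n
            ≤ γ n * ((m n : ℝ) / n) * C * m n := by gcongr
          _ = γ n * ((m n : ℝ) ^ 2 / n) * C := by ring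
    · have : 0 ≤ ∫ w, Y w ^ 4 ∂P := integral_nonneg fun _ => by positivity
      positivity
    · filter_upwards [hm.eventually_ge_atTop 1] with n hn
      have hm1 : (1 : ℝ) ≤ (m n : ℝ) ^ 2 := one_le_pow₀ (by exact_mod_cast hn)
      refine (hY.integral_residual_pow_four_le hη0.le hX hε (m n)).trans ?_
      have h1 : 0 ≤ ∫ w, Y w ^ 4 ∂P := integral_nonneg fun _ => by positivity
      nlinarith [mul_le_mul_of_nonneg_left hm1 h1]
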